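/- Theorem (strong local loop lemma). Let $A$ be a set, let $n\ge 0$ be an integer, let $t\colon A^n\to A$ be an operation, let $G$ be a digraph with vertex set $A$ (that is, an arbitrary binary relation $\to$ on $A$; $A$ may be infinite), and let $a_i,b_i\in A$ for $i\in\{0,\dots,n-1\}$. For $m\ge 0$, an $m$-walk from $v_0$ to $v_m$ in $G$ is a sequence of vertices $v_0,v_1,\dots,v_m$ with $v_j\to v_{j+1}$ for all $0\le j<m$; it is a cycle walk of length $m$ if $v_0=v_m$. For $i\in\{0,\dots,n-1\}$ let $P(t,i)$ be the digraph on $A$ whose edges are $x_i\to t(x_0,x_1,\dots,x_{n-1})$ for all $x_0,\dots,x_{n-1}\in A$, and let $\overline{P(t,i)}$ be its transitive closure. Assume that 1. $t$ is idempotent, i.e. $t(x,x,\dots,x)=x$ for all $x\in A$; 2. $G$ is compatible with $t$, i.e. if $x_j\to y_j$ in $G$ for every $j\in\{0,\dots,n-1\}$, then $t(x_0,\dots,x_{n-1})\to t(y_0,\dots,y_{n-1})$ in $G$; 3. either $G$ is strongly connected (for all $u,v\in A$ there is a walk from $u$ to $v$) and contains cycle walks of every length greater than one, or $G$ is undirected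 (its edge relation is symmetric), connected and non-bipartite; 4. for every $i\in\{0,\dots,n-1\}$, $a_i\to b_i$ is an edge of both $G$ and $\overline{P(t,i)}$. Then $G$ contains a loop, i.e. there is $v\in A$ with $v\to v$ in $G$. -/

import Mathlib

namespace LoopLemma

variable {A : Type*} {n : ℕ}

/-- `t(x, x, …, x) = x` for every `x`. -/
def Idempotent (t : (Fin n → A) → A) : Prop :=
  ∀ x : A, t (fun _ => x) = x

/-- The operation `t`, applied pointwise to edges of `G`, yields an edge of `G`. -/
def Compatible (G : Digraph A) (t : (Fin n → A) → A) : Prop :=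
  ∀ x y : Fin n → A, (∀ j, G.Adj (x j) (y j)) → G.Adj (t x) (t y)

/-- The word `[w 0, …, w m]` of vertices is an `m`-walk in `G`. -/
def IsWalk (G : Digraph A) {m : ℕ} (w : Fin (m + 1) → A) : Prop :=
  ∀ j : Fin m, G.Adj (w j.castSucc) (w j.succ)

/-- An `m`-walk whose first and last vertices coincide. -/
def IsCycleWalk (G : Digraph A) {m : ℕ} (w : Fin (m + 1) → A) : Prop :=
  IsWalk G w ∧ w 0 = w (Fin.last m)

/-- Between any two vertices there is a walk. -/
def StronglyConnected (G : Digraph A) : Prop :=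
  ∀ u v : A, ∃ (m : ℕ) (w : Fin (m + 1) → A), IsWalk G w ∧ w 0 = u ∧ w (Fin.last m) = v

/-- The edge relation is symmetric (loops are allowed). -/
def Undirected (G : Digraph A) : Prop :=
  ∀ u v : A, G.Adj u v → G.Adj v u

/-- The vertices split into two classes so that each edge joins vertices of different classes. -/
def Bipartite (G : Digraph A) : Prop :=
  ∃ S : Set A, ∀ u v : A, G.Adj u v → (u ∈ S ↔ v ∉ S)

/-- The digraph `P(t, i)` with the edges `x i → t x`, for all tuples `x`. -/
def coordDigraph (t : (Fin n → A) → A) (i : Fin n) : Digraph A where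
  Adj u v := ∃ x : Fin n → A, x i = u ∧ t x = v

/-- The transitive closure of a digraph. -/
def transClosure (G : Digraph A) : Digraph A where
  Adj := Relation.TransGen G.Adj

end LoopLemma

/-! Composing `t` with itself along a deep tree gives an idempotent, compatible operation T whose
coordinates are words. In a long word some letter i occurs so often that a whole walk from `a i` to
`b i` in P(t, i) can be absorbed along that one branch (`exists_treeOp_eq`). So every coordinate i
of T has a tuple x i with x i i → T (x i) in `G`.

A loop follows from a labelling f of the words of a fixed length over the index set of T with f(iu)
→ T(j ↦ f(uj)): applying T over the last letters again and again keeps these edges, until the value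
at the empty word has an edge to itself (`exists_loop_of_list`). Where f(uj) does not depend on j,
the condition is f(iu) → f(uj), so f should be a sliding block map from streams to walks of `G`. A
stream of period m forces a closed walk of length m, which is available for m ≥ 2 and missing only
for m = 1. There the tuples help: a constant window of i followed by j gets the label x i j, and the
edge x i i → T (x i) replaces the loop.

The block map comes from a marker lemma as in symbolic dynamics (`exists_markers`): markers are
sparse, and far from them the stream has a local period m < K. Markers get a vertex v₀; for m ≥ 2,
the starts of minimal blocks get a vertex on a closed m-walk; gaps are filled with walks, which
exist for every large length since closed walks of lengths 2 and 3 are at hand. Long constant runs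
are first left out as zones (`exists_local_rule`) and then filled (`cutRule`).

An undirected graph is reduced to this case by passing to walks whose length is two less than that
of a shortest odd closed walk. -/

namespace LoopLemma

/-- `Walk G g u v`: there is a `g`-step walk from `u` to `v` in `G`. -/
def Walk {A : Type*} (G : Digraph A) : ℕ → A → A → Prop
  | 0, u, v => u = v
  | g + 1, u, v => ∃ x, Walk G g u x ∧ G.Adj x v

/-! ### Walks of prescribed length -/

section Walk

variable {A : Type*} {G : Digraph A}

theorem Walk.single {u v : A} (h : G.Adj u v) : Walk G 1 u v := ⟨u, rfl, h⟩

theorem walk_one {u v : A} : Walk G 1 u v ↔ G.Adj u v :=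
  ⟨by rintro ⟨x, rfl, h⟩; exact h, Walk.single⟩

theorem Walk.trans {g k : ℕ} {u v x : A} (h : Walk G g u v) (h' : Walk G k v x) :
    Walk G (g + k) u x := by
  induction k generalizing x with
  | zero => cases h'; exact h
  | succ k ih =>
    obtain ⟨y, hy, hyx⟩ := h'
    exact ⟨y, ih hy, hyx⟩

theorem Walk.congr {g k : ℕ} {u v : A} (h : Walk G g u v) (e : g = k) : Walk G k u v := e ▸ h

theorem Walk.mul {g : ℕ} {u : A} (h : Walk G g u u) (k : ℕ) : Walk G (k * g) u u := by
  induction k with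
  | zero => exact (show Walk G 0 u u from rfl).congr (by simp)
  | succ k ih => exact (ih.trans h).congr (by ring)

theorem Walk.symm (hG : Undirected G) {g : ℕ} {u v : A} (h : Walk G g u v) : Walk G g v u := by
  induction g generalizing v with
  | zero => exact Eq.symm h
  | succ g ih =>
    obtain ⟨x, hx, hxv⟩ := h
    exact ((Walk.single (hG _ _ hxv)).trans (ih hx)).congr (by ring)

/-- The vertices of a walk, as a function on `ℕ`. -/
theorem Walk.exists_fun {g : ℕ} {u v : A} (h : Walk G g u v) :
    ∃ f : ℕ → A, f 0 = u ∧ f g = v ∧ ∀ k < g, G.Adj (f k) (f (k + 1)) := by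
  induction g generalizing v with
  | zero => exact ⟨fun _ => u, rfl, h, by simp⟩
  | succ g ih =>
    obtain ⟨x, hx, hxv⟩ := h
    obtain ⟨f, h0, hg, hf⟩ := ih hx
    refine ⟨fun k => if k ≤ g then f k else v, by simp [h0], by simp, fun k hk => ?_⟩
    rcases Nat.lt_succ_iff_lt_or_eq.1 hk with h | rfl
    · simpa [h.le, Nat.succ_le_of_lt h] using hf k h
    · simpa [hg] using hxv

theorem walk_of_isWalk {m : ℕ} (w : Fin (m + 1) → A) (hw : IsWalk G w) :
    Walk G m (w 0) (w (Fin.last m)) := by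
  induction m with
  | zero => rfl
  | succ m ih =>
    refine ⟨w (Fin.last m).castSucc, ?_, hw (Fin.last m)⟩
    exact ih (fun j => w j.castSucc) (fun j => hw j.castSucc)

theorem Walk.compatible {n : ℕ} {t : (Fin n → A) → A} (h_comp : Compatible G t)
    (g : ℕ) (x y : Fin n → A) (h : ∀ j, Walk G g (x j) (y j)) :
    Walk G g (t x) (t y) := by
  induction g generalizing y with
  | zero => exact congrArg t (funext h)
  | succ g ih =>
    choose z hz hzy using h
    exact ⟨t z, ih z hz, h_comp _ _ hzy⟩

/-- In a digraph with all walks between vertices and closed walks of lengths `2` and `3`, any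
two vertices are joined by walks of every large length. -/
theorem exists_walk_of_le (hsc : ∀ u v, ∃ g, Walk G g u v)
    (hcyc : ∀ m, 2 ≤ m → ∃ z, Walk G m z z) (u v : A) : ∃ K, ∀ g, K ≤ g → Walk G g u v := by
  obtain ⟨p, hp⟩ := hcyc 2 le_rfl
  obtain ⟨q, hq⟩ := hcyc 3 (by norm_num)
  obtain ⟨a, ha⟩ := hsc u p
  obtain ⟨b, hb⟩ := hsc p q
  obtain ⟨c, hc⟩ := hsc q v
  -- Every integer from 2 on has the form 2x + 3y.
  refine ⟨a + b + c + 2, fun g hg => ?_⟩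
  obtain ⟨x, y, hxy⟩ : ∃ x y : ℕ, g = a + x * 2 + b + y * 3 + c := by
    obtain ⟨d, rfl⟩ := Nat.exists_eq_add_of_le hg
    rcases Nat.even_or_odd' d with ⟨e, rfl | rfl⟩
    · exact ⟨e + 1, 0, by ring⟩
    · exact ⟨e, 1, by ring⟩
  exact ((((ha.trans (hp.mul x)).trans hb).trans (hq.mul y)).trans hc).congr hxy.symm

/-- A uniform version of `exists_walk_of_le` for finitely many vertices. -/
theorem exists_uniform_walk (hsc : ∀ u v, ∃ g, Walk G g u v)
    (hcyc : ∀ m, 2 ≤ m → ∃ z, Walk G m z z) (F : Finset A) :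
    ∃ K, ∀ u ∈ F, ∀ v ∈ F, ∀ g, K ≤ g → Walk G g u v := by
  choose k hk using exists_walk_of_le hsc hcyc
  refine ⟨∑ u ∈ F, ∑ v ∈ F, k u v, fun u hu v hv g hg => hk u v g (le_trans ?_ hg)⟩
  exact (Finset.single_le_sum (f := fun v => k u v) (fun _ _ => Nat.zero_le _) hv).trans
    (Finset.single_le_sum (f := fun u => ∑ v ∈ F, k u v) (fun _ _ => Nat.zero_le _) hu)

open scoped Classical in
/-- The `k`-th vertex of a chosen `g`-step walk from `u` to `v`; it is `u` for `k = 0`. -/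
noncomputable def walkVertex (G : Digraph A) (u v : A) (g k : ℕ) : A :=
  if h : Walk G g u v then h.exists_fun.choose k else u

theorem walkVertex_zero (u v : A) (g : ℕ) : walkVertex G u v g 0 = u := by
  unfold walkVertex
  split_ifs with h
  · exact h.exists_fun.choose_spec.1
  · rfl

theorem walkVertex_last {u v : A} {g : ℕ} (h : Walk G g u v) : walkVertex G u v g g = v := by
  unfold walkVertex
  rw [dif_pos h]
  exact h.exists_fun.choose_spec.2.1

theorem walkVertex_adj {u v : A} {g k : ℕ} (h : Walk G g u v) (hk : k < g) :
    G.Adj (walkVertex G u v g k) (walkVertex G u v g (k + 1)) := by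
  unfold walkVertex
  simp only [dif_pos h]
  exact h.exists_fun.choose_spec.2.2 k hk

end Walk

/-! ### Tree powers of the operation -/

section Power

variable {A : Type*} {n : ℕ}

/-- The `n ^ k`-ary operation obtained by composing `t` with itself along the full tree of
depth `k`. -/
def treeOp (t : (Fin n → A) → A) : (k : ℕ) → ((Fin k → Fin n) → A) → A
  | 0, f => f Fin.elim0
  | k + 1, f => t fun i => treeOp t k fun w => f (Fin.cons i w)

theorem treeOp_const {t : (Fin n → A) → A} (h_idem : Idempotent t) (k : ℕ) (x : A) :
    treeOp t k (fun _ => x) = x := by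
  induction k with
  | zero => rfl
  | succ k ih => simp only [treeOp, ih]; exact h_idem x

theorem treeOp_compatible {G : Digraph A} {t : (Fin n → A) → A} (h_comp : Compatible G t) (k : ℕ)
    (x y : (Fin k → Fin n) → A) (h : ∀ w, G.Adj (x w) (y w)) :
    G.Adj (treeOp t k x) (treeOp t k y) := by
  induction k with
  | zero => exact h _
  | succ k ih => exact h_comp _ _ fun i => ih _ _ fun w => h _

/-- A letter `i` occurring at least `g` times in `w` makes every `g`-step walk of `P(t, i)` a
single step at the coordinate `w` of the tree operation. -/
theorem exists_treeOp_eq {t : (Fin n → A) → A} (h_idem : Idempotent t) (i : Fin n) (k : ℕ)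
    (w : Fin k → Fin n) (g : ℕ) (hg : g ≤ (Finset.univ.filter fun j => w j = i).card) (u v : A)
    (h : Walk (coordDigraph t i) g u v) :
    ∃ x : (Fin k → Fin n) → A, x w = u ∧ treeOp t k x = v := by
  induction k generalizing g v with
  | zero =>
    have : g = 0 := by simpa using hg
    subst this
    exact ⟨fun _ => u, rfl, h⟩
  | succ k ih =>
    have key : ∀ (v' : A) (y : Fin n → A), (∃ x : (Fin k → Fin n) → A, x (Fin.tail w) = u ∧
        treeOp t k x = v') → y (w 0) = v' → t y = v →
        ∃ x : (Fin (k + 1) → Fin n) → A, x w = u ∧ treeOp t (k + 1) x = v := by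
      rintro v' y ⟨x, hx, rfl⟩ hy rfl
      -- The subtree below `w 0` uses `x`; every other subtree is constant and collapses to the
      -- entry of `y` by idempotence.
      refine ⟨fun w' => if w' 0 = w 0 then x (Fin.tail w') else y (w' 0), by simpa using hx, ?_⟩
      simp only [treeOp, Fin.cons_zero, Fin.tail_cons]
      congr 1
      funext j
      by_cases hj : j = w 0
      · subst hj; simp [hy]
      · simp [hj, treeOp_const h_idem]
    have hcard : (Finset.univ.filter fun j => w j = i).card =
        (if w 0 = i then 1 else 0) + (Finset.univ.filter fun j => Fin.tail w j = i).card := by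
      rw [Fin.card_filter_univ_succ]
      split_ifs <;> simp [Fin.tail, add_comm] <;> rfl
    by_cases hw : w 0 = i
    · rcases g with _ | g
      -- The walk is used up, so this level idles with a constant tuple.
      · exact key v (fun _ => v) (ih _ 0 (Nat.zero_le _) v h) rfl (h_idem v)
      · obtain ⟨v', hv', y, hy, hyv⟩ := h
        refine key v' y (ih _ g ?_ v' hv') (hw ▸ hy) hyv
        rw [hcard, if_pos hw] at hg
        omega
    · refine key v (fun _ => v) (ih _ g ?_ v h) rfl (h_idem v)
      rw [hcard, if_neg hw] at hg
      omega

theorem exists_walk_of_transGen {G : Digraph A} {u v : A} (h : Relation.TransGen G.Adj u v) :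
    ∃ g, Walk G g u v := by
  induction h with
  | single h => exact ⟨1, Walk.single h⟩
  | tail _ h ih =>
    obtain ⟨g, hg⟩ := ih
    exact ⟨g + 1, _, hg, h⟩

end Power

/-! ### From labelled words to a loop -/

section ListLoop

variable {A I : Type*}

/-- The value at the word `w` of the labelling of the tree of words, computed by `T` from the
labels `f` at the words that are `k` letters longer. -/
def treeValue (T : (I → A) → A) (f : List I → A) : ℕ → List I → A
  | 0, w => f w
  | k + 1, w => T fun j => treeValue T f k (w ++ [j])

/-- A labelling of words such that dropping the first letter is an edge gives a loop. -/
theorem exists_loop_of_list {G : Digraph A} {T : (I → A) → A} (hT : ∀ x, T (fun _ => x) = x)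
    (hG : ∀ x y : I → A, (∀ j, G.Adj (x j) (y j)) → G.Adj (T x) (T y)) (N : ℕ) (f : List I → A)
    (hf : ∀ (i : I) (u : List I), u.length = N → G.Adj (f (i :: u)) (T fun j => f (u ++ [j]))) :
    ∃ v, G.Adj v v := by
  have key : ∀ k ≤ N, ∀ (i : I) (u : List I), u.length = N - k →
      G.Adj (treeValue T f k (i :: u)) (treeValue T f (k + 1) u) := by
    intro k
    induction k with
    | zero => intro _ i u hu; exact hf i u hu
    | succ k ih =>
      intro hk i u hu
      refine hG _ _ fun j => ?_
      exact ih (by omega) i (u ++ [j]) (by simp; omega)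
  refine ⟨treeValue T f (N + 1) [], ?_⟩
  -- All one-letter words have edges to the same vertex, the value at the empty word. Applying T
  -- turns the sources into that value too.
  have h := hG _ _ fun i => key N le_rfl i [] (by simp)
  rw [hT] at h
  exact h

end ListLoop

/-! ### Windows of streams, least periods and markers -/

section Streams

variable {I : Type*}

/-- The streams `s` and `s'` agree on the windows of radius `ρ` around `p` and `p'`. -/
def Agree (ρ : ℤ) (s : ℤ → I) (p : ℤ) (s' : ℤ → I) (p' : ℤ) : Prop :=
  ∀ k, -ρ ≤ k → k ≤ ρ → s (p + k) = s' (p' + k)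

theorem Agree.symm {ρ : ℤ} {s s' : ℤ → I} {p p' : ℤ} (h : Agree ρ s p s' p') :
    Agree ρ s' p' s p := fun k h1 h2 => (h k h1 h2).symm

theorem Agree.shift {ρ τ : ℤ} {s s' : ℤ → I} {p p' : ℤ} (h : Agree τ s p s' p') (j : ℤ)
    (h1 : ρ + j ≤ τ) (h2 : ρ - j ≤ τ) : Agree ρ s (p + j) s' (p' + j) := fun k hk hk' => by
  have := h (j + k) (by omega) (by omega)
  rwa [← add_assoc, ← add_assoc] at this

theorem Agree.mono {ρ τ : ℤ} {s s' : ℤ → I} {p p' : ℤ} (h : Agree τ s p s' p') (h1 : ρ ≤ τ) :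
    Agree ρ s p s' p' := fun k hk hk' => h k (by omega) (by omega)

/-- The window of radius `w` around `p` has the period `m`. -/
def HasPer (w : ℤ) (s : ℤ → I) (p : ℤ) (m : ℕ) : Prop :=
  ∀ k, -w ≤ k → k + m ≤ w → s (p + k) = s (p + k + m)

theorem HasPer.congr {w : ℤ} {s s' : ℤ → I} {p p' : ℤ} {m : ℕ} (h : Agree w s p s' p')
    (hp : HasPer w s p m) : HasPer w s' p' m := fun k h1 h2 => by
  have e1 := h k h1 (by omega)
  have e2 := h (k + m) (by omega) h2
  rw [← add_assoc, ← add_assoc] at e2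
  rw [← e1, ← e2]
  exact hp k h1 h2

theorem HasPer.add_mul {w : ℤ} {s : ℤ → I} {p : ℤ} {m : ℕ} (hp : HasPer w s p m) (i : ℕ) (k : ℤ)
    (h1 : -w ≤ k) (h2 : k + m * i ≤ w) : s (p + k) = s (p + k + m * i) := by
  induction i with
  | zero => simp
  | succ i ih =>
    have e : k + m * ((i + 1 : ℕ) : ℤ) = k + m * i + m := by push_cast; ring
    have h0 : (0 : ℤ) ≤ m * i := by positivity
    rw [ih (by omega), add_assoc p k, hp (k + m * i) (by omega) (by omega)]
    congr 1
    push_cast; ring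

/-- Positions in the window that are congruent modulo the period carry the same letter. -/
theorem HasPer.eq_of_emod {w : ℤ} {s : ℤ → I} {p : ℤ} {m : ℕ} (hp : HasPer w s p m) {k k' : ℤ}
    (hk : -w ≤ k) (hk' : k ≤ w) (hl : -w ≤ k') (hl' : k' ≤ w) (h : k % m = k' % m) :
    s (p + k) = s (p + k') := by
  wlog hle : k ≤ k' generalizing k k'
  · exact (this hl hl' hk hk' h.symm (by omega)).symm
  obtain ⟨c, hc⟩ : (m : ℤ) ∣ k' - k := Int.ModEq.dvd h
  rcases Nat.eq_zero_or_pos m with rfl | hm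
  · have : k = k' := by simpa using h
    rw [this]
  have hc0 : 0 ≤ c := by
    by_contra hneg
    have : (m : ℤ) * c < 0 := mul_neg_of_pos_of_neg (by exact_mod_cast hm) (by omega)
    omega
  lift c to ℕ using hc0
  have := hp.add_mul c k hk (by omega)
  rw [this]
  congr 1
  omega

/-- Short periods of a window are periods of the next window, provided the latter has a short
period at all. -/
theorem HasPer.succ {w : ℤ} {s : ℤ → I} {p : ℤ} {m m' : ℕ} (hm : (m : ℤ) + m' ≤ w)
    (h0' : 1 ≤ m') (hp : HasPer w s p m) (hp' : HasPer w s (p + 1) m') : HasPer w s (p + 1) m := by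
  intro k h1 h2
  by_cases hk : k + 1 + m ≤ w
  · have := hp (k + 1) (by omega) hk
    rw [show p + 1 + k = p + (k + 1) by ring, this]
  -- Only the pair with the newly entered letter is left. It is compared by going back `m'`, back
  -- `m` and forward `m'`.
  · have hk : k = w - m := by omega
    subst hk
    have e1 := hp' (w - m') (by omega) (by omega)
    have e2 := hp (w + 1 - m' - m) (by omega) (by omega)
    have e3 := hp' (w - m' - m) (by omega) (by omega)
    rw [show p + 1 + (w - m) + m = p + 1 + (w - m') + m' by ring, ← e1,
      show p + 1 + (w - m') = p + (w + 1 - m' - m) + m by ring, ← e2,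
      show p + (w + 1 - m' - m) = p + 1 + (w - m' - m) by ring, e3]
    congr 1
    ring

theorem HasPer.pred {w : ℤ} {s : ℤ → I} {p : ℤ} {m m' : ℕ} (hm : (m : ℤ) + m' ≤ w)
    (h0 : 1 ≤ m) (hp : HasPer w s p m) (hp' : HasPer w s (p + 1) m') : HasPer w s p m' := by
  intro k h1 h2
  by_cases hk : -w ≤ k - 1
  · have := hp' (k - 1) hk (by omega)
    rw [show p + k = p + 1 + (k - 1) by ring, this]
  · have hk : k = -w := by omega
    subst hk
    have e1 := hp (-w) le_rfl (by omega)
    have e2 := hp' (-w + m - 1) (by omega) (by omega)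
    have e3 := hp (-w + m') (by omega) (by omega)
    rw [e1, add_assoc p (-w) m', e3, show p + -w + m = p + 1 + (-w + m - 1) by ring, e2]
    congr 1
    ring

/-- The least positive period of the window of radius `w` around `p`. -/
noncomputable def minPer (w : ℤ) (s : ℤ → I) (p : ℤ) : ℕ := sInf {m | 1 ≤ m ∧ HasPer w s p m}

theorem minPer_congr {w : ℤ} {s s' : ℤ → I} {p p' : ℤ} (h : Agree w s p s' p') :
    minPer w s p = minPer w s' p' := by
  unfold minPer
  congr 1
  ext m
  exact and_congr_right fun _ => ⟨HasPer.congr h, HasPer.congr h.symm⟩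

theorem minPer_spec (w : ℤ) (s : ℤ → I) (p : ℤ) :
    1 ≤ minPer w s p ∧ HasPer w s p (minPer w s p) := by
  -- A period longer than the window holds vacuously.
  refine Nat.sInf_mem (s := {m | 1 ≤ m ∧ HasPer w s p m}) ⟨2 * w.toNat + 1, by omega, ?_⟩
  intro k h1 h2
  push_cast at h2
  omega

theorem minPer_le {w : ℤ} {s : ℤ → I} {p : ℤ} {m : ℕ} (h1 : 1 ≤ m) (h : HasPer w s p m) :
    minPer w s p ≤ m := Nat.sInf_le ⟨h1, h⟩

/-- In the manner of Fine and Wilf, each of the two least periods is also a period of the other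
window when both are short. -/
theorem minPer_succ {w : ℤ} {s : ℤ → I} {p : ℤ}
    (h : (minPer w s p : ℤ) + minPer w s (p + 1) ≤ w) : minPer w s (p + 1) = minPer w s p := by
  have h1 := minPer_spec w s p
  have h2 := minPer_spec w s (p + 1)
  exact le_antisymm (minPer_le h1.1 (h1.2.succ h h2.1 h2.2))
    (minPer_le h2.1 (h1.2.pred h h1.1 h2.2))

/-- A marker lemma: a locally defined set of positions that are at distance at least `K` from each
other, such that far from it the stream is locally periodic with a period less than `K`. -/
theorem exists_markers [Finite I] {K : ℕ} (hK : 0 < K) (w : ℤ) :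
    ∃ (S : (ℤ → I) → ℤ → Prop) (σ : ℤ), 0 ≤ σ ∧
      (∀ s p s' p', Agree σ s p s' p' → S s p → S s' p') ∧
      (∀ s p (j : ℤ), 0 < j → j < K → S s p → ¬ S s (p + j)) ∧
      (∀ s p, S s p → K ≤ minPer w s p) ∧
      (∀ s p, K ≤ minPer w s p → ∃ j : ℤ, -K < j ∧ j < K ∧ S s (p + j)) := by
  classical
  cases nonempty_fintype (Set.Icc (-w) w → I)
  let pat : (ℤ → I) → ℤ → (Set.Icc (-w) w → I) := fun s p k => s (p + k)
  have hpat : ∀ s p s' p', pat s p = pat s' p' ↔ Agree w s p s' p' := fun s p s' p' =>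
    ⟨fun h k h1 h2 => congrFun h ⟨k, h1, h2⟩, fun h => funext fun k => h k k.2.1 k.2.2⟩
  suffices H : ∀ U : Finset (Set.Icc (-w) w → I), ∃ (S : (ℤ → I) → ℤ → Prop) (σ : ℤ), 0 ≤ σ ∧
      (∀ s p s' p', Agree σ s p s' p' → S s p → S s' p') ∧
      (∀ s p (j : ℤ), 0 < j → j < K → S s p → ¬ S s (p + j)) ∧
      (∀ s p, S s p → K ≤ minPer w s p) ∧
      (∀ s p, pat s p ∈ U → K ≤ minPer w s p → ∃ j : ℤ, -K < j ∧ j < K ∧ S s (p + j)) by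
    obtain ⟨S, σ, h0, h1, h2, h3, h4⟩ := H Finset.univ
    exact ⟨S, σ, h0, h1, h2, h3, fun s p => h4 s p (Finset.mem_univ _)⟩
  intro U
  induction U using Finset.induction_on with
  | empty => exact ⟨fun _ _ => False, 0, le_rfl, by simp⟩
  | insert u U _ ih =>
    obtain ⟨S, σ, h0, h1, h2, h3, h4⟩ := ih
    -- Greedy step: a position with pattern `u` becomes a marker unless an older marker is closer
    -- than `K`. The radius grows by `K` for this test and by `|w|` for reading the pattern.
    refine ⟨fun s p => S s p ∨ (pat s p = u ∧ K ≤ minPer w s p ∧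
      ∀ j : ℤ, -K < j → j < K → ¬ S s (p + j)), σ + K + |w|, by positivity, ?_, ?_, ?_, ?_⟩
    · rintro s p s' p' h (hS | ⟨hu, hm, hS⟩)
      · exact Or.inl (h1 _ _ _ _ (h.mono (by linarith [abs_nonneg w])) hS)
      · have hw := h.mono (show w ≤ _ by linarith [le_abs_self w])
        refine Or.inr ⟨((hpat _ _ _ _).2 hw).symm.trans hu, minPer_congr hw ▸ hm,
          fun j hj hj' hS' => hS j hj hj' (h1 _ _ _ _ ?_ hS')⟩
        exact h.symm.shift j (by linarith [abs_nonneg w]) (by linarith [abs_nonneg w])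
    · rintro s p j hj hj' (hS | ⟨hu, hm, hS⟩) (hS' | ⟨hu', hm', hS'⟩)
      · exact h2 s p j hj hj' hS hS'
      · exact hS' (-j) (by omega) (by omega) (by simpa using hS)
      · exact hS j (by omega) hj' hS'
      -- Two new markers show the same pattern, so their distance `j` is a period of the window and
      -- cannot be below `K`.
      · have hag := (hpat _ _ _ _).1 (hu.trans hu'.symm)
        lift j to ℕ using hj.le
        have : HasPer w s p j := fun k hk hk' => by
          rw [hag k hk (by omega)]
          congr 1
          ring
        have := minPer_le (by exact_mod_cast hj) this
        omega
    · rintro s p (hS | ⟨_, hm, _⟩)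
      · exact h3 s p hS
      · exact hm
    · intro s p hp hm
      by_cases hS : ∃ j : ℤ, -K < j ∧ j < K ∧ S s (p + j)
      · obtain ⟨j, hj, hj', hS⟩ := hS
        exact ⟨j, hj, hj', Or.inl hS⟩
      · rcases Finset.mem_insert.1 hp with hu | hU
        · refine ⟨0, by omega, by omega, Or.inr ⟨by simpa using hu, by simpa using hm, ?_⟩⟩
          intro j hj hj' hj''
          exact hS ⟨j, hj, hj', by simpa using hj''⟩
        · exact absurd (h4 s p hU hm) hS

/-- A number that encodes the block of length `m` that begins at `p`. -/
noncomputable def blockCode [Finite I] (m : ℕ) (s : ℤ → I) (p : ℤ) : ℕ :=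
  (Finite.equivFin (Set.Ico (0 : ℤ) m → I) fun k => s (p + k)).val

theorem blockCode_eq_iff [Finite I] {m : ℕ} {s s' : ℤ → I} {p p' : ℤ} :
    blockCode m s p = blockCode m s' p' ↔ ∀ k : ℤ, 0 ≤ k → k < m → s (p + k) = s' (p' + k) := by
  rw [blockCode, blockCode, Fin.val_inj, Equiv.apply_eq_iff_eq]
  exact ⟨fun h k h1 h2 => congrFun h ⟨k, h1, h2⟩, fun h => funext fun k => h k k.2.1 k.2.2⟩

/-- Blocks at a distance of less than the least period are different. -/
theorem blockCode_ne [Finite I] {w : ℤ} {s : ℤ → I} {p : ℤ} {j : ℕ} (hw : 2 * minPer w s p ≤ w)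
    (h1 : 1 ≤ j) (h2 : j < minPer w s p) :
    blockCode (minPer w s p) s p ≠ blockCode (minPer w s p) s (p + j) := by
  intro h
  rw [blockCode_eq_iff] at h
  obtain ⟨hm, hper⟩ := minPer_spec w s p
  set m := minPer w s p with hmdef
  have hm' : (0 : ℤ) < m := by omega
  -- Positions are reduced modulo `m` into the block, where the equality of codes applies.
  have : HasPer w s p j := fun k hk hk' => by
    have hk0 := Int.emod_nonneg k hm'.ne'
    have hk1 := Int.emod_lt_of_pos k hm'
    have e1 : s (p + k) = s (p + k % m) :=
      hper.eq_of_emod hk (by omega) (by omega) (by omega) (by simp)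
    have e2 : s (p + (k + j)) = s (p + (k % m + j)) :=
      hper.eq_of_emod (by omega) hk' (by omega) (by omega) (by simp)
    rw [e1, h _ hk0 hk1, add_assoc p k, e2]
    congr 1
    ring
  have := minPer_le h1 this
  omega

end Streams

/-! ### Filling the gaps of a partial labelling with walks -/

section Interpolation

variable {A : Type*} {G : Digraph A}

/-- Given a partial labelling of `ℤ`, the label at `p` of the chosen walk from the last labelled
position not after `p` to the first one after `p`. -/
noncomputable def interpolate (G : Digraph A) (v₀ : A) (L : ℤ → Option A) (p : ℤ) : A :=
  walkVertex G ((L (p - (sInf {k : ℕ | (L (p - k)).isSome} : ℕ))).getD v₀)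
    ((L (p + 1 + (sInf {k : ℕ | (L (p + 1 + k)).isSome} : ℕ))).getD v₀)
    (sInf {k : ℕ | (L (p - k)).isSome} + sInf {k : ℕ | (L (p + 1 + k)).isSome} + 1)
    (sInf {k : ℕ | (L (p - k)).isSome})

theorem sInf_eq_of_isLeast {P : ℕ → Prop} {a : ℕ} (ha : P a) (hlt : ∀ k < a, ¬ P k) :
    sInf {k | P k} = a :=
  le_antisymm (Nat.sInf_le ha) (le_csInf ⟨a, ha⟩ fun k hk => not_lt.1 fun h => hlt k h hk)

/-- No walk has to exist here: vertex 0 of `walkVertex` is the start in the default case as well. -/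
theorem interpolate_of_eq_some {v₀ u : A} {L : ℤ → Option A} {p : ℤ} (h : L p = some u) :
    interpolate G v₀ L p = u := by
  have h0 : sInf {k : ℕ | (L (p - k)).isSome} = 0 :=
    sInf_eq_of_isLeast (by simp [h]) (by simp)
  unfold interpolate
  rw [h0, walkVertex_zero]
  simp [h]

theorem interpolate_eq {v₀ u v : A} {L : ℤ → Option A} {p : ℤ} {a g : ℕ} (ha : a < g)
    (hu : L p = some u) (hv : L (p + g) = some v)
    (hnone : ∀ k : ℕ, 0 < k → k < g → L (p + k) = none) :
    interpolate G v₀ L (p + a) = walkVertex G u v g a := by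
  have h0 : sInf {k : ℕ | (L (p + a - k)).isSome} = a := by
    refine sInf_eq_of_isLeast (by simp [hu]) fun k hk => ?_
    have := hnone (a - k) (by omega) (by omega)
    rw [show p + a - (k : ℤ) = p + ((a - k : ℕ) : ℤ) by push_cast [hk.le]; ring, this]
    simp
  have h1 : sInf {k : ℕ | (L (p + a + 1 + k)).isSome} = g - a - 1 := by
    refine sInf_eq_of_isLeast ?_ fun k hk => ?_
    · rw [show p + a + 1 + ((g - a - 1 : ℕ) : ℤ) = p + g by omega, hv]
      simp
    · rw [show p + a + 1 + (k : ℤ) = p + ((a + 1 + k : ℕ) : ℤ) by push_cast; ring,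
        hnone _ (by omega) (by omega)]
      simp
  unfold interpolate
  rw [h0, h1, show p + a + 1 + ((g - a - 1 : ℕ) : ℤ) = p + g by omega, hv,
    show p + (a : ℤ) - a = p by ring, hu, show a + (g - a - 1) + 1 = g by omega]
  rfl

/-- The labelled positions around an unlabelled position. -/
theorem exists_neighbours {L : ℤ → Option A} {p : ℤ} {B : ℕ}
    (h1 : ∃ k : ℕ, k ≤ B ∧ (L (p - k)).isSome) (h2 : ∃ k : ℕ, k ≤ B ∧ (L (p + 1 + k)).isSome) :
    ∃ (q : ℤ) (a g : ℕ) (u v : A), p = q + a ∧ a < g ∧ a ≤ B ∧ g ≤ a + B + 1 ∧ L q = some u ∧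
      L (q + g) = some v ∧ ∀ k : ℕ, 0 < k → k < g → L (q + k) = none := by
  classical
  have h1' : ∃ k : ℕ, (L (p - k)).isSome := h1.imp fun _ h => h.2
  have h2' : ∃ k : ℕ, (L (p + 1 + k)).isSome := h2.imp fun _ h => h.2
  obtain ⟨b1, hb1, hb1'⟩ := h1
  obtain ⟨b2, hb2, hb2'⟩ := h2
  obtain ⟨u, hu⟩ := Option.isSome_iff_exists.1 (Nat.find_spec h1')
  obtain ⟨v, hv⟩ := Option.isSome_iff_exists.1 (Nat.find_spec h2')
  have l1 := Nat.find_min' h1' hb1'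
  have l2 := Nat.find_min' h2' hb2'
  have m1 := fun k => Nat.find_min h1' (m := k)
  have m2 := fun k => Nat.find_min h2' (m := k)
  generalize Nat.find h1' = a at *
  generalize Nat.find h2' = b at *
  refine ⟨p - a, a, a + b + 1, u, v, by ring, by omega, by omega, by omega, hu, ?_, ?_⟩
  · rw [← hv]; congr 1; push_cast; ring
  · intro k hk hk'
    by_cases hka : k ≤ a
    · have := m1 (a - k) (by omega)
      rw [show p - ((a - k : ℕ) : ℤ) = p - a + k by push_cast [hka]; ring] at this
      simpa using this
    · have := m2 (k - a - 1) (by omega)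
      rw [show p + 1 + ((k - a - 1 : ℕ) : ℤ) = p - a + k by omega] at this
      simpa using this

/-- The interpolation inherits locality from the labels. A labelled `p` needs no label to its right,
which matters in front of a zone that may never end. -/
theorem interpolate_congr {v₀ : A} {L L' : ℤ → Option A} {p p' : ℤ} {B : ℕ}
    (h1 : ∃ k : ℕ, k ≤ B ∧ (L (p - k)).isSome)
    (h2 : (L p).isSome ∨ ∃ k : ℕ, k ≤ B ∧ (L (p + 1 + k)).isSome)
    (h : ∀ k : ℤ, -B ≤ k → k ≤ B + 1 → L (p + k) = L' (p' + k)) :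
    interpolate G v₀ L p = interpolate G v₀ L' p' := by
  rcases h2 with h2 | h2
  · obtain ⟨u, hu⟩ := Option.isSome_iff_exists.1 h2
    have := h 0 (by omega) (by omega)
    rw [add_zero, add_zero, hu] at this
    rw [interpolate_of_eq_some hu, interpolate_of_eq_some this.symm]
  · obtain ⟨q, a, g, u, v, rfl, hag, haB, hgB, hu, hv, hnone⟩ := exists_neighbours h1 h2
    have hL : ∀ k : ℕ, k ≤ g → L (q + k) = L' (p' - a + k) := fun k hk => by
      have := h (k - a) (by omega) (by omega)
      rw [show q + k = q + a + (k - a) by ring, this]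
      congr 1; ring
    rw [interpolate_eq hag hu hv hnone, show p' = p' - a + a by ring]
    refine (interpolate_eq hag ?_ ?_ ?_).symm
    · simpa [hu] using (hL 0 (by omega)).symm
    · rw [← hL g le_rfl, hv]
    · intro k hk hk'
      rw [← hL k hk'.le, hnone k hk hk']

theorem interpolate_adj {v₀ : A} {L : ℤ → Option A} {p : ℤ} {B : ℕ}
    (h1 : ∃ k : ℕ, k ≤ B ∧ (L (p - k)).isSome) (h2 : ∃ k : ℕ, k ≤ B ∧ (L (p + 1 + k)).isSome)
    (hwalk : ∀ (q : ℤ) (a g : ℕ) (u v : A), p = q + a → a < g → L q = some u →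
      L (q + g) = some v → (∀ k : ℕ, 0 < k → k < g → L (q + k) = none) → Walk G g u v) :
    G.Adj (interpolate G v₀ L p) (interpolate G v₀ L (p + 1)) := by
  obtain ⟨q, a, g, u, v, rfl, hag, -, -, hu, hv, hnone⟩ := exists_neighbours h1 h2
  have hw := hwalk q a g u v rfl hag hu hv hnone
  rw [interpolate_eq hag hu hv hnone]
  have hadj := walkVertex_adj hw hag
  by_cases hlast : a + 1 < g
  · rw [show q + (a : ℤ) + 1 = q + ((a + 1 : ℕ) : ℤ) by push_cast; ring,
      interpolate_eq hlast hu hv hnone]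
    exact hadj
  · obtain rfl : g = a + 1 := by omega
    rw [walkVertex_last hw] at hadj
    rw [interpolate_of_eq_some (u := v) (by rw [← hv]; congr 1; push_cast; ring)]
    exact hadj

end Interpolation

/-! ### Zones inside long constant runs -/

section Zones

variable {I : Type*}

/-- The position `p` is deep inside a long constant run of `s`. -/
def Zone (μ κ : ℤ) (s : ℤ → I) (p : ℤ) : Prop :=
  ∃ j, 0 ≤ j ∧ j ≤ κ ∧ ∀ k, -μ ≤ k → k ≤ κ + μ → s (p - j + k) = s p

variable {μ κ : ℤ} {s s' : ℤ → I} {p p' : ℤ}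

theorem Zone.const (h : Zone μ κ s p) {q : ℤ} (h1 : p - μ ≤ q) (h2 : q ≤ p + μ) : s q = s p := by
  obtain ⟨j, hj, hj', h⟩ := h
  have := h (q - p + j) (by omega) (by omega)
  rwa [show p - j + (q - p + j) = q by ring] at this

theorem Zone.of_const (hκ : 0 ≤ κ) (h : ∀ q, p - μ ≤ q → q ≤ p + κ + μ → s q = s p) :
    Zone μ κ s p := ⟨0, le_rfl, hκ, fun k h1 h2 => h _ (by omega) (by omega)⟩

/-- The long constant window is kept while `p` moves inside it, and slides along once `p` reaches
its right limit. Hence a zone ends only at distance `μ` from the end of its run. -/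
theorem Zone.succ (hμ : 1 ≤ μ) (h : Zone μ κ s p) (hs : s (p + μ + 1) = s p) :
    Zone μ κ s (p + 1) := by
  have h1 : s (p + 1) = s p := h.const (by omega) (by omega)
  obtain ⟨j, hj, hj', h⟩ := h
  by_cases hjκ : j < κ
  · refine ⟨j + 1, by omega, by omega, fun k hk hk' => ?_⟩
    rw [h1, ← h k hk hk']
    congr 1; ring
  · refine ⟨κ, by omega, le_rfl, fun k hk hk' => ?_⟩
    by_cases hk'' : k + 1 ≤ κ + μ
    · rw [h1, ← h (k + 1) (by omega) hk'']
      congr 1; omega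
    · rw [h1, ← hs]
      congr 1; omega

theorem Zone.pred (hμ : 1 ≤ μ) (h : Zone μ κ s (p + 1)) (hs : s (p - μ) = s (p + 1)) :
    Zone μ κ s p := by
  have h1 : s p = s (p + 1) := h.const (by omega) (by omega)
  obtain ⟨j, hj, hj', h⟩ := h
  by_cases hjκ : 0 < j
  · refine ⟨j - 1, by omega, by omega, fun k hk hk' => ?_⟩
    rw [h1, ← h k hk hk']
    congr 1; ring
  · refine ⟨0, by omega, by omega, fun k hk hk' => ?_⟩
    by_cases hk'' : -μ ≤ k - 1
    · rw [h1, ← h (k - 1) (by omega) (by omega)]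
      congr 1; omega
    · rw [h1, ← hs]
      congr 1; omega

theorem Zone.congr {ρ : ℤ} (hρ : κ + μ ≤ ρ) (h : Agree ρ s p s' p')
    (hz : Zone μ κ s p) : Zone μ κ s' p' := by
  obtain ⟨j, hj, hj', hz⟩ := hz
  refine ⟨j, hj, hj', fun k hk hk' => ?_⟩
  have e1 := h (-j + k) (by omega) (by omega)
  have e2 := h 0 (by omega) (by omega)
  rw [add_zero, add_zero] at e2
  rw [← e2, ← hz k hk hk', show p' - j + k = p' + (-j + k) by ring, ← e1]
  congr 1; ring

/-- A position with a window that is not constant is far from every constant window. -/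
theorem two_le_minPer_far {w : ℤ} (h : 2 ≤ minPer w s p) {q : ℤ} {c : I}
    (hq : ∀ k, q - μ ≤ k → k ≤ q + μ → s k = c) : p - w < q - μ ∨ q + μ < p + w := by
  by_contra! hcon
  have : HasPer w s p 1 := fun k h1 h2 => by
    push_cast at h2 ⊢
    rw [hq _ (by omega) (by omega), hq _ (by omega) (by omega)]
  have := minPer_le le_rfl this
  omega

end Zones

/-! ### Markers, phase marks and the lengths of gaps -/

section Labels

variable {A I : Type*}

/-- No marker at a distance of at most `κ` from `p`. -/
def MarkerFree (S : (ℤ → I) → ℤ → Prop) (κ : ℤ) (s : ℤ → I) (p : ℤ) : Prop :=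
  ∀ j, -κ ≤ j → j ≤ κ → ¬ S s (p + j)

/-- The position `p` begins a minimal block in a region of period between `2` and `K - 1`. -/
def PhaseMark [Finite I] (S : (ℤ → I) → ℤ → Prop) (K κ : ℕ) (w : ℤ) (s : ℤ → I) (p : ℤ) : Prop :=
  MarkerFree S κ s p ∧ 2 ≤ minPer w s p ∧ minPer w s p < K ∧
    ∀ j : ℕ, j < minPer w s p →
      blockCode (minPer w s p) s p ≤ blockCode (minPer w s p) s (p + j)

open scoped Classical in
/-- The vertices assigned to markers, phase marks, and the positions around a zone. -/
noncomputable def label [Finite I] (S : (ℤ → I) → ℤ → Prop) (K κ : ℕ) (w μ : ℤ) (v₀ : A)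
    (z : ℕ → A) (y : I → A) (s : ℤ → I) (p : ℤ) : Option A :=
  if S s p then some v₀
  else if PhaseMark S K κ w s p then some (z (minPer w s p))
  else if ¬ Zone μ κ s p ∧ Zone μ κ s (p + 1) then some (y (s (p + 1)))
  else if Zone μ κ s (p - 1) ∧ ¬ Zone μ κ s p then some v₀
  else none

/-- What is assumed of the markers: they are defined by windows of radius `σ`, at distance at
least `K`, at places without a period less than `K`, and not far from each such place. -/
structure IsMarker (S : (ℤ → I) → ℤ → Prop) (K : ℕ) (w σ : ℤ) : Prop where
  nonneg : 0 ≤ σ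
  congr : ∀ s p s' p', Agree σ s p s' p' → S s p → S s' p'
  sep : ∀ s p (j : ℤ), 0 < j → j < K → S s p → ¬ S s (p + j)
  le_minPer : ∀ s p, S s p → K ≤ minPer w s p
  exists_near : ∀ s p, K ≤ minPer w s p → ∃ j : ℤ, -K < j ∧ j < K ∧ S s (p + j)

variable {S : (ℤ → I) → ℤ → Prop} {K κ : ℕ} {w μ σ : ℤ} {v₀ : A} {z : ℕ → A}
  {y : I → A} {s s' : ℤ → I} {p p' : ℤ}

theorem MarkerFree.congr (hS : IsMarker S K w σ) {ρ : ℤ} (hρ : σ + κ ≤ ρ) (h : Agree ρ s p s' p')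
    (hf : MarkerFree S κ s p) : MarkerFree S κ s' p' := fun j h1 h2 hj =>
  hf j h1 h2 (hS.congr _ _ _ _ (h.symm.shift j (by omega) (by omega)) hj)

theorem PhaseMark.congr [Finite I] (hS : IsMarker S K w σ) (hw : 4 * (K : ℤ) ≤ w) {ρ : ℤ}
    (hρ : σ + κ ≤ ρ)
    (hwρ : w ≤ ρ) (h : Agree ρ s p s' p') (hf : PhaseMark S K κ w s p) :
    PhaseMark S K κ w s' p' := by
  obtain ⟨h1, h2, h3, h4⟩ := hf
  have hm := minPer_congr (h.mono hwρ)
  rw [hm] at h2 h3 h4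
  refine ⟨h1.congr hS hρ h, h2, h3, fun j hj => ?_⟩
  have e : ∀ j : ℕ, j < minPer w s' p' → blockCode (minPer w s' p') s (p + j) =
      blockCode (minPer w s' p') s' (p' + j) := fun j hj => by
    rw [blockCode_eq_iff]
    intro k hk hk'
    rw [add_assoc, add_assoc]
    exact h _ (by omega) (by omega)
  have e0 := e 0 (by omega)
  simp only [Nat.cast_zero, add_zero] at e0
  rw [← e0, ← e j hj]
  exact h4 j hj

theorem label_congr [Finite I] (hS : IsMarker S K w σ) (hw : 4 * (K : ℤ) ≤ w) {ρ : ℤ}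
    (hρ : σ + κ ≤ ρ)
    (hwρ : w ≤ ρ) (hμ : 0 ≤ μ)
    (hμρ : κ + μ + 1 ≤ ρ) (h : Agree ρ s p s' p') :
    label S K κ w μ v₀ z y s p = label S K κ w μ v₀ z y s' p' := by
  have e1 : S s p = S s' p' := propext
    ⟨hS.congr _ _ _ _ (h.mono (by omega)), hS.congr _ _ _ _ (h.symm.mono (by omega))⟩
  have e2 : PhaseMark S K κ w s p = PhaseMark S K κ w s' p' := propext
    ⟨PhaseMark.congr hS hw hρ hwρ h, PhaseMark.congr hS hw hρ hwρ h.symm⟩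
  have e3 : ∀ j : ℤ, -1 ≤ j → j ≤ 1 → Zone μ κ s (p + j) = Zone μ κ s' (p' + j) :=
    fun j h1 h2 => propext
      ⟨Zone.congr le_rfl (h.shift j (by omega) (by omega)),
        Zone.congr le_rfl (h.symm.shift j (by omega) (by omega))⟩
  have e4 := e3 0 (by omega) (by omega)
  have e5 := e3 (-1) (by omega) (by omega)
  have e6 : s (p + 1) = s' (p' + 1) := h 1 (by omega) (by omega)
  simp only [add_zero, ← sub_eq_add_neg] at e4 e5
  unfold label
  rw [e1, e2, e3 1 (by omega) le_rfl, e4, e5, e6, minPer_congr (h.mono hwρ)]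

theorem eq_of_label [Finite I] (h : label S K κ w μ v₀ z y s p = some v) :
    (S s p ∧ v = v₀) ∨ (PhaseMark S K κ w s p ∧ v = z (minPer w s p)) ∨
    ((¬ Zone μ κ s p ∧ Zone μ κ s (p + 1)) ∧ v = y (s (p + 1))) ∨
    ((Zone μ κ s (p - 1) ∧ ¬ Zone μ κ s p) ∧ v = v₀) := by
  unfold label at h
  split_ifs at h with h1 h2 h3 h4
  · exact Or.inl ⟨h1, (Option.some.inj h).symm⟩
  · exact Or.inr (Or.inl ⟨h2, (Option.some.inj h).symm⟩)
  · exact Or.inr (Or.inr (Or.inl ⟨h3, (Option.some.inj h).symm⟩))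
  · exact Or.inr (Or.inr (Or.inr ⟨h4, (Option.some.inj h).symm⟩))

theorem not_of_label_eq_none [Finite I] (h : label S K κ w μ v₀ z y s p = none) :
    ¬ S s p ∧ ¬ PhaseMark S K κ w s p ∧ ¬ (¬ Zone μ κ s p ∧ Zone μ κ s (p + 1)) ∧
    ¬ (Zone μ κ s (p - 1) ∧ ¬ Zone μ κ s p) := by
  unfold label at h
  split_ifs at h with h1 h2 h3 h4
  exact ⟨h1, h2, h3, h4⟩

/-- The least period does not change along a region without markers. -/
theorem minPer_eq_of_markerFree (hS : IsMarker S K w σ) (hw : 4 * (K : ℤ) ≤ w) (k : ℕ)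
    (hf : ∀ j : ℤ, -K < j → j < k + K → ¬ S s (p + j)) :
    minPer w s (p + k) = minPer w s p ∧ minPer w s (p + k) < K := by
  have hlt : ∀ i : ℕ, i ≤ k → minPer w s (p + i) < K := fun i hi => by
    by_contra! hcon
    obtain ⟨j, h1, h2, h3⟩ := hS.exists_near _ _ hcon
    exact hf (i + j) (by omega) (by omega) (by rwa [← add_assoc])
  refine ⟨?_, hlt k le_rfl⟩
  induction k with
  | zero => simp
  | succ k ih =>
    rw [← ih (fun j h1 h2 => hf j h1 (by push_cast; omega)) fun i hi => hlt i (by omega)]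
    have h1 := hlt k (by omega)
    have h2 := hlt (k + 1) le_rfl
    push_cast at h2 ⊢
    rw [← add_assoc] at h2 ⊢
    exact minPer_succ (by omega)

theorem blockCode_add_minPer [Finite I] (k : ℤ) (h1 : -w ≤ k) (h2 : k + 2 * minPer w s p ≤ w) :
    blockCode (minPer w s p) s (p + k + minPer w s p) = blockCode (minPer w s p) s (p + k) := by
  rw [blockCode_eq_iff]
  intro i hi hi'
  have := (minPer_spec w s p).2 (k + i) (by omega) (by omega)
  rw [show p + k + i = p + (k + i) by ring, this]
  congr 1; ring

/-- Consecutive phase marks that are close to each other are one period apart. -/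
theorem PhaseMark.eq_minPer [Finite I] (hS : IsMarker S K w σ) (hw : 4 * (K : ℤ) ≤ w) (hK : K ≤ κ)
    {g : ℕ} (hg : 0 < g) (hgκ : g < κ) (h : PhaseMark S K κ w s p) (h' : PhaseMark S K κ w s (p + g))
    (hnone : ∀ k : ℕ, 0 < k → k < g → ¬ PhaseMark S K κ w s (p + k)) :
    g = minPer w s p ∧ minPer w s (p + g) = minPer w s p := by
  have hfree : ∀ j : ℤ, -κ ≤ j → j ≤ g + κ → ¬ S s (p + j) := fun j h1 h2 => by
    by_cases hj : j ≤ κ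
    · exact h.1 j h1 hj
    · have := h'.1 (j - g) (by omega) (by omega)
      rwa [show p + (g : ℤ) + (j - g) = p + j by ring] at this
  have hper : ∀ k : ℕ, k ≤ g → minPer w s (p + k) = minPer w s p := fun k hk =>
    (minPer_eq_of_markerFree hS hw k fun j h1 h2 => hfree j (by omega) (by omega)).1
  refine ⟨?_, hper g le_rfl⟩
  obtain ⟨-, h2, h3, h4⟩ := h
  obtain ⟨-, -, -, h4'⟩ := h'
  rw [hper g le_rfl] at h4'
  have e0 := blockCode_add_minPer (s := s) (p := p) (w := w) 0 (by omega) (by omega)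
  rw [add_zero] at e0
  by_contra hne
  rcases lt_or_gt_of_ne hne with hlt | hgt
  -- Too close: both blocks would be minimal within one period, hence equal.
  · refine blockCode_ne (w := w) (by omega) (by omega : 1 ≤ g) hlt (le_antisymm (h4 g hlt) ?_)
    have := h4' (minPer w s p - g) (by omega)
    rwa [show p + (g : ℤ) + ((minPer w s p - g : ℕ) : ℤ) = p + minPer w s p by omega, e0] at this
  -- Too far: the position one period after `p` would be a phase mark in between.
  · refine hnone (minPer w s p) (by omega) hgt ⟨?_, ?_⟩
    · intro j h1 h2
      rw [add_assoc]
      exact hfree _ (by omega) (by omega)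
    · rw [hper _ hgt.le]
      refine ⟨h2, h3, fun j hj => ?_⟩
      have := blockCode_add_minPer (s := s) (p := p) (w := w) j (by omega) (by omega)
      rw [e0, show p + (minPer w s p : ℤ) + j = p + j + minPer w s p by ring, this]
      exact h4 j hj

/-- Every long interval contains a labelled position or meets a zone. -/
theorem exists_label_or_zone [Finite I] (hS : IsMarker S K w σ) (hw : w = 4 * (K : ℤ))
    (hμ : μ = 4 * K + κ + 2) (h2K : 2 ≤ K) (hK : K ≤ κ) (s : ℤ → I) (p : ℤ) :
    ∃ k : ℕ, k ≤ 9 * K + 5 * κ + 5 ∧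
      ((label S K κ w μ v₀ z y s (p + k)).isSome ∨ Zone μ κ s (p + k)) := by
  by_contra! hcon
  have hn : ∀ k : ℕ, k ≤ 9 * K + 5 * κ + 5 → ¬ S s (p + k) ∧ ¬ PhaseMark S K κ w s (p + k) :=
    fun k hk => by
      have := not_of_label_eq_none (Option.not_isSome_iff_eq_none.1 (by simpa using (hcon k hk).1))
      exact ⟨this.1, this.2.1⟩
  have hfree : ∀ j : ℤ, 0 ≤ j → j ≤ 9 * K + 5 * κ + 5 → ¬ S s (p + j) := fun j h1 h2 => by
    lift j to ℕ using h1
    exact (hn j (by omega)).1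
  -- Without markers nearby the least period is below `K`; if it were at least 2, the least block
  -- among the starts in one period would give a phase mark.
  have hone : ∀ k : ℕ, κ ≤ k → k ≤ 8 * K + 4 * κ + 5 → minPer w s (p + k) = 1 := by
    intro k hk hk'
    have hper : ∀ j : ℕ, j < K → minPer w s (p + k + j) = minPer w s (p + k) ∧
        minPer w s (p + k + j) < K := fun j hj =>
      minPer_eq_of_markerFree hS hw.ge j fun i h1 h2 => by
        rw [add_assoc]
        exact hfree _ (by omega) (by omega)
    have h1 := (minPer_spec w s (p + k)).1
    by_contra hne
    have hmK : minPer w s (p + k) < K := by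
      by_contra! hle
      obtain ⟨j, hj, hj', hSj⟩ := hS.exists_near _ _ hle
      exact hfree (k + j) (by omega) (by omega) (by rwa [← add_assoc])
    obtain ⟨j, hj, hmin⟩ := Finset.exists_min_image (Finset.range (minPer w s (p + k)))
      (fun j : ℕ => blockCode (minPer w s (p + k)) s (p + k + j)) ⟨0, by simp; omega⟩
    rw [Finset.mem_range] at hj
    have hpj := (hper j (by omega)).1
    refine (hn (k + j) (by omega)).2 ⟨fun i h1 h2 => ?_, ?_⟩
    · rw [add_assoc]
      exact hfree _ (by push_cast; omega) (by push_cast; omega)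
    · push_cast
      rw [← add_assoc, hpj]
      refine ⟨by omega, hmK, fun i hi => ?_⟩
      by_cases hji : j + i < minPer w s (p + k)
      · have := hmin (j + i) (Finset.mem_range.2 hji)
        rwa [Nat.cast_add, ← add_assoc] at this
      · have := hmin (j + i - minPer w s (p + k)) (Finset.mem_range.2 (by omega))
        refine this.trans (le_of_eq ?_)
        rw [← blockCode_add_minPer (s := s) (p := p + k) (w := w) _ (by omega) (by omega)]
        congr 1
        omega
  have hconst : ∀ k : ℕ, k ≤ 8 * K + 3 * κ + 5 → s (p + κ + k) = s (p + κ) := by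
    intro k
    induction k with
    | zero => simp
    | succ k ih =>
      intro hk
      have hp := (minPer_spec w s (p + (κ + k : ℕ))).2
      rw [hone _ (by omega) (by omega)] at hp
      have := hp 0 (by omega) (by push_cast; omega)
      rw [← ih (by omega), show p + (κ : ℤ) + k = p + (κ + k : ℕ) + 0 by push_cast; ring, this]
      congr 1
      push_cast; ring
  have hconst' : ∀ q, p + κ ≤ q → q ≤ p + 8 * K + 4 * κ + 5 → s q = s (p + κ) := fun q h1 h2 => by
    have := hconst (q - p - κ).toNat (by omega)
    rwa [show p + κ + ((q - p - κ).toNat : ℤ) = q by omega] at this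
  -- This position lies `μ` after the start of the constant stretch, with `κ + μ` letters of the
  -- stretch still ahead, so it is in a zone.
  refine (hcon (4 * K + 2 * κ + 2) (by omega)).2 (Zone.of_const (by omega) fun q h1 h2 => ?_)
  push_cast at h1 h2 ⊢
  rw [hconst' q (by omega) (by omega), hconst' (p + (4 * K + 2 * κ + 2)) (by omega) (by omega)]

/-- The labels at consecutive labelled positions with no zone between are joined by a walk. -/
theorem walk_of_labels [Finite I] {G : Digraph A} (hS : IsMarker S K w σ) (hw : w = 4 * (K : ℤ))
    (hμ : μ = 4 * K + κ + 2) (h2K : 2 ≤ K) (hK : K ≤ κ) {F : Set A} (hv₀ : v₀ ∈ F)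
    (hzF : ∀ m, z m ∈ F) (hyF : ∀ i, y i ∈ F)
    (hF : ∀ u ∈ F, ∀ v ∈ F, ∀ g, κ ≤ g → Walk G g u v) (hvv : ∀ g, K ≤ g → Walk G g v₀ v₀)
    (hz : ∀ m, 2 ≤ m → m < K → Walk G m (z m) (z m)) {g : ℕ} (hg : 0 < g) {u v : A}
    (hu : label S K κ w μ v₀ z y s p = some u) (hv : label S K κ w μ v₀ z y s (p + g) = some v)
    (hnone : ∀ k : ℕ, 0 < k → k < g → label S K κ w μ v₀ z y s (p + k) = none)
    (hzone : ∀ k : ℕ, k ≤ g → ¬ Zone μ κ s (p + k)) : Walk G g u v := by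
  have hu' := eq_of_label hu
  have hv' := eq_of_label hv
  by_cases hgκ : κ ≤ g
  · refine hF _ ?_ _ ?_ g hgκ
    · rcases hu' with ⟨-, rfl⟩ | ⟨-, rfl⟩ | ⟨-, rfl⟩ | ⟨-, rfl⟩ <;> simp [*]
    · rcases hv' with ⟨-, rfl⟩ | ⟨-, rfl⟩ | ⟨-, rfl⟩ | ⟨-, rfl⟩ <;> simp [*]
  have hY : ¬ Zone μ κ s (p + 1) := by simpa using hzone 1 hg
  have hC : ¬ Zone μ κ s (p + g - 1) := by
    have := hzone (g - 1) (by omega)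
    rwa [show p + ((g - 1 : ℕ) : ℤ) = p + g - 1 by omega] at this
  have hfar : ∀ q, (S s q ∨ PhaseMark S K κ w s q) → 2 ≤ minPer w s q := fun q hq =>
    hq.elim (fun h => h2K.trans (hS.le_minPer _ _ h)) fun h => h.2.1
  -- Since `μ = w + κ + 2` and `g < κ`, a zone just past the gap would make the window of radius `w`
  -- at its other end constant, against a least period of at least 2. `hend` is the mirror image.
  have hstart : (S s p ∨ PhaseMark S K κ w s p) → ¬ Zone μ κ s (p + g + 1) := fun h hzn => by
    have := two_le_minPer_far (μ := μ) (hfar p h) fun k h1 h2 => hzn.const h1 h2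
    omega
  have hend : (S s (p + g) ∨ PhaseMark S K κ w s (p + g)) → ¬ Zone μ κ s (p - 1) := fun h hzn => by
    have := two_le_minPer_far (μ := μ) (hfar _ h) fun k h1 h2 => hzn.const h1 h2
    omega
  rcases hu' with ⟨h1, rfl⟩ | ⟨h1, rfl⟩ | ⟨h1, rfl⟩ | ⟨h1, rfl⟩
  · rcases hv' with ⟨h2, rfl⟩ | ⟨h2, rfl⟩ | ⟨h2, rfl⟩ | ⟨h2, rfl⟩
    · refine hvv g ?_
      by_contra! hlt
      exact hS.sep s p g (by omega) (by omega) h1 h2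
    · exact absurd h1 (by simpa using h2.1 (-g) (by omega) (by omega))
    · exact absurd h2.2 (hstart (Or.inl h1))
    · exact absurd h2.1 hC
  · rcases hv' with ⟨h2, rfl⟩ | ⟨h2, rfl⟩ | ⟨h2, rfl⟩ | ⟨h2, rfl⟩
    · exact absurd h2 (h1.1 g (by omega) (by omega))
    · obtain ⟨e1, e2⟩ := h1.eq_minPer hS hw.ge hK hg (by omega) h2 fun k hk hk' =>
        (not_of_label_eq_none (hnone k hk hk')).2.1
      rw [e2, ← e1]
      exact hz g (e1 ▸ h1.2.1) (e1 ▸ h1.2.2.1)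
    · exact absurd h2.2 (hstart (Or.inr h1))
    · exact absurd h2.1 hC
  · exact absurd h1.2 hY
  · rcases hv' with ⟨h2, rfl⟩ | ⟨h2, rfl⟩ | ⟨h2, rfl⟩ | ⟨h2, rfl⟩
    · exact absurd h1.1 (hend (Or.inl h2))
    · exact absurd h1.1 (hend (Or.inr h2))
    -- Zones on both sides of so short a gap lie in one constant run, and then the first would
    -- extend to `p`.
    · refine absurd (h1.1.succ (by omega) ?_) (by simpa using h1.2)
      have e1 : s (p - 1) = s (p + g + 1) := h2.2.const (by omega) (by omega)
      rw [e1]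
      exact h2.2.const (by omega) (by omega)
    · exact absurd h2.1 hC

end Labels

/-! ### The local rule outside the zones -/

section LocalRule

variable {A I : Type*} {S : (ℤ → I) → ℤ → Prop} {K κ : ℕ} {w μ σ : ℤ} {v₀ : A} {z : ℕ → A}
  {y : I → A} {s : ℤ → I} {p : ℤ}

/-- A zone within distance 1 makes the whole window of radius `w` constant, so its least period is
1. -/
theorem not_marker_of_zone [Finite I] (hS : IsMarker S K w σ) (hwμ : w + 1 ≤ μ) (h2K : 2 ≤ K)
    {q : ℤ} (h1 : p - 1 ≤ q) (h2 : q ≤ p + 1) (hz : Zone μ κ s q) :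
    ¬ S s p ∧ ¬ PhaseMark S K κ w s p := by
  have key : ¬ 2 ≤ minPer w s p := fun h => by
    have := two_le_minPer_far (μ := μ) h fun k h1 h2 => hz.const h1 h2
    omega
  exact ⟨fun h => key (h2K.trans (hS.le_minPer _ _ h)), fun h => key h.2.1⟩

theorem label_of_zone_succ [Finite I] (hS : IsMarker S K w σ) (hwμ : w + 1 ≤ μ) (h2K : 2 ≤ K)
    (h : ¬ Zone μ κ s p) (h' : Zone μ κ s (p + 1)) :
    label S K κ w μ v₀ z y s p = some (y (s (p + 1))) := by
  obtain ⟨h1, h2⟩ := not_marker_of_zone hS hwμ h2K (by omega) le_rfl h'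
  rw [label, if_neg h1, if_neg h2, if_pos ⟨h, h'⟩]

theorem label_of_zone_pred [Finite I] (hS : IsMarker S K w σ) (hwμ : w + 1 ≤ μ) (hw : 1 ≤ w)
    (h2K : 2 ≤ K) (h : ¬ Zone μ κ s (p + 1)) (h' : Zone μ κ s p) :
    label S K κ w μ v₀ z y s (p + 1) = some v₀ := by
  have hp : p + 1 - 1 = p := by ring
  obtain ⟨h1, h2⟩ := not_marker_of_zone (p := p + 1) hS hwμ h2K hp.le (by omega) h'
  -- The label in front of a zone has precedence, so a gap of one position between two zones must be
  -- excluded.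
  have h3 : ¬ Zone μ κ s (p + 1 + 1) := fun h3 => h <| by
    refine h'.succ (by omega) ?_
    have e1 : s p = s (p + 1 + 1) := h3.const (by omega) (by omega)
    rw [e1]
    exact h3.const (by omega) (by omega)
  rw [label, if_neg h1, if_neg h2, if_neg (fun h => h3 h.2), if_pos ⟨by rwa [hp], h⟩]

/-- Searching backwards, either a label or a zone comes first; in the second case the position just
after the zone is labelled. -/
theorem exists_label_before [Finite I] (hS : IsMarker S K w σ) (hw : w = 4 * (K : ℤ))
    (hμ : μ = 4 * K + κ + 2) (h2K : 2 ≤ K) (hK : K ≤ κ) (h : ¬ Zone μ κ s p) :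
    ∃ k : ℕ, k ≤ 9 * K + 5 * κ + 5 ∧ (label S K κ w μ v₀ z y s (p - k)).isSome := by
  classical
  have hex : ∃ k : ℕ, (label S K κ w μ v₀ z y s (p - k)).isSome ∨ Zone μ κ s (p - k) := by
    obtain ⟨k, hk, hk'⟩ := exists_label_or_zone (v₀ := v₀) (z := z) (y := y) hS hw hμ h2K hK s
      (p - (9 * K + 5 * κ + 5 : ℕ))
    refine ⟨9 * K + 5 * κ + 5 - k, ?_⟩
    rwa [show p - ((9 * K + 5 * κ + 5 - k : ℕ) : ℤ) = p - (9 * K + 5 * κ + 5 : ℕ) + k by omega]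
  have hle : Nat.find hex ≤ 9 * K + 5 * κ + 5 := by
    obtain ⟨k, hk, hk'⟩ := exists_label_or_zone (v₀ := v₀) (z := z) (y := y) hS hw hμ h2K hK s
      (p - (9 * K + 5 * κ + 5 : ℕ))
    refine (Nat.find_min' hex (m := 9 * K + 5 * κ + 5 - k) ?_).trans (by omega)
    rwa [show p - ((9 * K + 5 * κ + 5 - k : ℕ) : ℤ) = p - (9 * K + 5 * κ + 5 : ℕ) + k by omega]
  have hspec := Nat.find_spec hex
  have hmin := fun k => Nat.find_min hex (m := k)
  generalize Nat.find hex = k at *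
  rcases hspec with hk | hk
  · exact ⟨k, hle, hk⟩
  · have hk0 : k ≠ 0 := by rintro rfl; exact h (by simpa using hk)
    have hn := fun h => hmin (k - 1) (by omega) (Or.inr h)
    rw [show p - ((k - 1 : ℕ) : ℤ) = p - k + 1 by omega] at hn
    refine ⟨k - 1, by omega, ?_⟩
    rw [show p - ((k - 1 : ℕ) : ℤ) = p - k + 1 by omega,
      label_of_zone_pred hS (by omega) (by omega) h2K hn hk]
    rfl

theorem exists_label_after [Finite I] (hS : IsMarker S K w σ) (hw : w = 4 * (K : ℤ))
    (hμ : μ = 4 * K + κ + 2) (h2K : 2 ≤ K) (hK : K ≤ κ) (h : ¬ Zone μ κ s p) :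
    ∃ k : ℕ, k ≤ 9 * K + 5 * κ + 5 ∧ (label S K κ w μ v₀ z y s (p + k)).isSome := by
  classical
  obtain ⟨k', hk, hk'⟩ := exists_label_or_zone (v₀ := v₀) (z := z) (y := y) hS hw hμ h2K hK s p
  have hex : ∃ k : ℕ, (label S K κ w μ v₀ z y s (p + k)).isSome ∨ Zone μ κ s (p + k) := ⟨k', hk'⟩
  have hle := (Nat.find_min' hex hk').trans hk
  have hspec := Nat.find_spec hex
  have hmin := fun k => Nat.find_min hex (m := k)
  generalize Nat.find hex = k at *
  rcases hspec with hk | hk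
  · exact ⟨k, hle, hk⟩
  · have hk0 : k ≠ 0 := by rintro rfl; exact h (by simpa using hk)
    have hn := fun h => hmin (k - 1) (by omega) (Or.inr h)
    rw [show p + k = p + ((k - 1 : ℕ) : ℤ) + 1 by omega] at hk
    exact ⟨k - 1, by omega, by rw [label_of_zone_succ hS (by omega) h2K hn hk]; rfl⟩

/-- A locally defined homomorphism from the shift to `G` outside the zones. -/
theorem exists_local_rule [Finite I] {G : Digraph A} (hμ : μ = 4 * K + κ + 2) (h2K : 2 ≤ K)
    (hK : K ≤ κ) {F : Set A} (hv₀ : v₀ ∈ F) (hzF : ∀ m, z m ∈ F) (hyF : ∀ i, y i ∈ F)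
    (hF : ∀ u ∈ F, ∀ v ∈ F, ∀ g, κ ≤ g → Walk G g u v) (hvv : ∀ g, K ≤ g → Walk G g v₀ v₀)
    (hz : ∀ m, 2 ≤ m → m < K → Walk G m (z m) (z m)) :
    ∃ (ρ : ℤ) (θ : (ℤ → I) → ℤ → A), 0 ≤ ρ ∧
      (∀ s p s' p', Agree ρ s p s' p' → ¬ Zone μ κ s p → θ s p = θ s' p') ∧
      (∀ s p, ¬ Zone μ κ s p → ¬ Zone μ κ s (p + 1) → G.Adj (θ s p) (θ s (p + 1))) ∧
      (∀ s p, ¬ Zone μ κ s p → Zone μ κ s (p + 1) → θ s p = y (s (p + 1))) ∧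
      (∀ s p, Zone μ κ s p → ¬ Zone μ κ s (p + 1) → θ s (p + 1) = v₀) := by
  obtain ⟨S, σ, h1, h2, h3, h4, h5⟩ := exists_markers (I := I) (by omega : 0 < K) (4 * (K : ℤ))
  have hS : IsMarker S K (4 * (K : ℤ)) σ := ⟨h1, h2, h3, h4, h5⟩
  have hafter : ∀ {s : ℤ → I} {p : ℤ}, ¬ Zone μ κ s p → _ := fun {s p} h =>
    exists_label_after (v₀ := v₀) (z := z) (y := y) hS rfl hμ h2K hK h
  have hbefore : ∀ {s : ℤ → I} {p : ℤ}, ¬ Zone μ κ s p → _ := fun {s p} h =>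
    exists_label_before (v₀ := v₀) (z := z) (y := y) hS rfl hμ h2K hK h
  refine ⟨σ + κ + μ + 4 * K + (9 * K + 5 * κ + 5) + 1,
    fun s => interpolate G v₀ (label S K κ (4 * K) μ v₀ z y s), by omega, ?_, ?_, ?_, ?_⟩
  · intro s p s' p' h hp
    refine interpolate_congr (hbefore hp) ?_ fun k hk hk' =>
      label_congr (ρ := σ + κ + μ + 4 * K) hS le_rfl (by omega) (by omega) (by omega) (by omega)
        (h.shift k (by push_cast at hk'; omega) (by push_cast at hk; omega))
    by_cases hp1 : Zone μ κ s (p + 1)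
    · left
      rw [label_of_zone_succ hS (by omega) h2K hp hp1]
      rfl
    · exact Or.inr (hafter hp1)
  · intro s p hp hp1
    refine interpolate_adj (hbefore hp) (hafter hp1) ?_
    intro q a g u v hpq hag hu hv hnone
    have hn := fun k h h' => not_of_label_eq_none (hnone k h h')
    refine walk_of_labels hS rfl hμ h2K hK hv₀ hzF hyF hF hvv hz (by omega) hu hv hnone ?_
    -- No zone can begin or end inside a gap, as the positions next to a zone are labelled. So the
    -- absence of zones spreads from `p` and `p + 1` over the whole gap.
    have hleft : ∀ k : ℕ, k ≤ a → ¬ Zone μ κ s (q + (a - k : ℕ)) := by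
      intro k
      induction k with
      | zero => intro _; rw [Nat.sub_zero, ← hpq]; exact hp
      | succ k ih =>
        intro hk hzn
        refine (hn (a - k) (by omega) (by omega)).2.2.2 ⟨?_, ih (by omega)⟩
        rwa [show q + ((a - k : ℕ) : ℤ) - 1 = q + (a - (k + 1) : ℕ) by omega]
    have hright : ∀ k : ℕ, a + 1 + k ≤ g → ¬ Zone μ κ s (q + (a + 1 + k : ℕ)) := by
      intro k
      induction k with
      | zero =>
        intro _
        rw [show q + ((a + 1 + 0 : ℕ) : ℤ) = p + 1 by omega]
        exact hp1
      | succ k ih =>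
        intro hk hzn
        refine (hn (a + 1 + k) (by omega) (by omega)).2.2.1 ⟨ih (by omega), ?_⟩
        rwa [show q + ((a + 1 + k : ℕ) : ℤ) + 1 = q + (a + 1 + (k + 1) : ℕ) by omega]
    intro k hk
    by_cases hka : k ≤ a
    · have := hleft (a - k) (by omega)
      rwa [show a - (a - k) = k by omega] at this
    · have := hright (k - a - 1) (by omega)
      rwa [show a + 1 + (k - a - 1) = k by omega] at this
  · intro s p hp hp1
    exact interpolate_of_eq_some (label_of_zone_succ hS (by omega) h2K hp hp1)
  · intro s p hp hp1
    exact interpolate_of_eq_some (label_of_zone_pred hS (by omega) (by omega) h2K hp1 hp)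

end LocalRule

/-! ### Filling the zones -/

section CutRule

variable {A I : Type*}

/-- The distance from `p` to the next letter that differs from the one at `p`. -/
noncomputable def runAfter (s : ℤ → I) (p : ℤ) : ℕ := sInf {k : ℕ | s (p + k) ≠ s p}

/-- The distance from `p` to the last letter before `p` that differs from the one at `p`. -/
noncomputable def runBefore (s : ℤ → I) (p : ℤ) : ℕ := sInf {k : ℕ | s (p - k) ≠ s p}

theorem runAfter_eq {s : ℤ → I} {p : ℤ} {r : ℕ} (h : s (p + r) ≠ s p)
    (h' : ∀ k : ℕ, k < r → s (p + k) = s p) : runAfter s p = r :=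
  sInf_eq_of_isLeast h fun k hk => not_not.2 (h' k hk)

theorem runBefore_eq {s : ℤ → I} {p : ℤ} {r : ℕ} (h : s (p - r) ≠ s p)
    (h' : ∀ k : ℕ, k < r → s (p - k) = s p) : runBefore s p = r :=
  sInf_eq_of_isLeast h fun k hk => not_not.2 (h' k hk)

/-- A constant window from `p - μ` to `p + M`. -/
def ConstWindow (μ M : ℕ) (s : ℤ → I) (p : ℤ) : Prop :=
  ∀ q, p - μ ≤ q → q ≤ p + M → s q = s p

/-- The constant run at `p` has length at least `μ + M + 1`. -/
def LongRun (μ M : ℕ) (s : ℤ → I) (p : ℤ) : Prop :=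
  ∀ q, p + runAfter s p - (μ + M + 1) ≤ q → q ≤ p → s q = s p

open scoped Classical in
/-- The rule that extends `θ` to zones: zones in runs of length at most `μ + M` are filled with a
walk, while in longer runs the vertices `x i j` are used at the constant windows. -/
noncomputable def cutRule (G : Digraph A) (x : I → I → A) (v₀ : A) (θ : (ℤ → I) → ℤ → A)
    (κ μ M : ℕ) (s : ℤ → I) (p : ℤ) : A :=
  if ConstWindow μ M s p then x (s p) (s (p + M + 1))
  else if ¬ Zone μ κ s p then θ s p
  else if LongRun μ M s p then
    walkVertex G (x (s p) (s (p + runAfter s p))) v₀ (M + 1 - μ) (M + 1 - runAfter s p)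
  else
    walkVertex G (x (s p) (s p)) v₀ (runBefore s p + runAfter s p - 2 * μ) (runBefore s p - μ)

variable {G : Digraph A} {x : I → I → A} {v₀ : A} {θ : (ℤ → I) → ℤ → A} {κ μ M c : ℕ} {ρ : ℤ}
  {s s' : ℤ → I} {p p' : ℤ}

theorem ConstWindow.zone (hM : κ + μ ≤ M) (h : ConstWindow μ M s p) : Zone μ κ s p :=
  Zone.of_const (by omega) fun q h1 h2 => h q h1 (by omega)

theorem exists_runAfter (h : ¬ ConstWindow μ M s p) (hz : Zone μ κ s p) :
    μ < runAfter s p ∧ runAfter s p ≤ M ∧ s (p + runAfter s p) ≠ s p ∧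
      ∀ q, p - μ ≤ q → q < p + runAfter s p → s q = s p := by
  classical
  unfold ConstWindow at h
  push Not at h
  obtain ⟨q, h1, h2, h3⟩ := h
  have hq : p + μ < q := by
    by_contra! hle
    exact h3 (hz.const h1 hle)
  have hex : ∃ k : ℕ, s (p + k) ≠ s p := ⟨(q - p).toNat, by
    rwa [show p + ((q - p).toNat : ℤ) = q by omega]⟩
  have hspec := Nat.find_spec hex
  have hmin := fun k => Nat.find_min hex (m := k)
  have hle : Nat.find hex ≤ (q - p).toNat := Nat.find_min' hex (by
    rwa [show p + ((q - p).toNat : ℤ) = q by omega])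
  generalize Nat.find hex = r at *
  have hr : runAfter s p = r := runAfter_eq hspec fun k hk => not_not.1 (hmin k hk)
  rw [hr]
  refine ⟨?_, by omega, hspec, fun q' hq1 hq2 => ?_⟩
  · by_contra! hrμ
    exact hspec (hz.const (by omega) (by omega))
  · by_cases hq' : p ≤ q'
    · have := not_not.1 (hmin (q' - p).toNat (by omega))
      rwa [show p + ((q' - p).toNat : ℤ) = q' by omega] at this
    · exact hz.const hq1 (by omega)

theorem exists_runBefore (h : ¬ LongRun μ M s p) (hz : Zone μ κ s p) :
    μ < runBefore s p ∧ runBefore s p + runAfter s p ≤ μ + M + 1 ∧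
      s (p - runBefore s p) ≠ s p ∧ ∀ q, p - runBefore s p < q → q ≤ p → s q = s p := by
  classical
  unfold LongRun at h
  push Not at h
  obtain ⟨q, h1, h2, h3⟩ := h
  have hq : q < p - μ := by
    by_contra! hle
    exact h3 (hz.const hle (by omega))
  have hex : ∃ k : ℕ, s (p - k) ≠ s p := ⟨(p - q).toNat, by
    rwa [show p - ((p - q).toNat : ℤ) = q by omega]⟩
  have hspec := Nat.find_spec hex
  have hmin := fun k => Nat.find_min hex (m := k)
  have hle : Nat.find hex ≤ (p - q).toNat := Nat.find_min' hex (by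
    rwa [show p - ((p - q).toNat : ℤ) = q by omega])
  generalize Nat.find hex = r at *
  have hr : runBefore s p = r := runBefore_eq hspec fun k hk => not_not.1 (hmin k hk)
  rw [hr]
  refine ⟨?_, by omega, hspec, fun q' hq1 hq2 => ?_⟩
  · by_contra! hrμ
    exact hspec (hz.const (by omega) (by omega))
  · have := not_not.1 (hmin (p - q').toNat (by omega))
    rwa [show p - ((p - q').toNat : ℤ) = q' by omega] at this

/-- Runs that contain a zone are long. -/
theorem le_run_of_zone (hz : Zone μ κ s p) (h1 : s (p - runBefore s p) ≠ s p)
    (h2 : s (p + runAfter s p) ≠ s p) : 2 * μ + κ + 2 ≤ runBefore s p + runAfter s p := by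
  obtain ⟨j, hj, hj', hz⟩ := hz
  have h3 : ¬ (-(μ : ℤ) ≤ j - runBefore s p) := fun h => h1 <| by
    rw [← hz (j - runBefore s p) h (by omega)]; congr 1; ring
  have h4 : ¬ (j + runAfter s p ≤ (κ : ℤ) + μ) := fun h => h2 <| by
    rw [← hz (j + runAfter s p) (by omega) h]; congr 1; ring
  omega

/-- The rule at `p` depends on the window from `p - c` to `p + M` only, if this is not constant. -/
theorem cutRule_congr (hρ : ρ ≤ M) (hM : κ + μ ≤ M) (hcM : μ + M + 1 ≤ c)
    (hθ : ∀ s p s' p', Agree ρ s p s' p' → ¬ Zone μ κ s p → θ s p = θ s' p')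
    (h : ∀ k : ℤ, -c ≤ k → k ≤ M → s (p + k) = s' (p' + k)) (hp : ¬ ConstWindow μ M s p) :
    cutRule G x v₀ θ κ μ M s p = cutRule G x v₀ θ κ μ M s' p' := by
  have h0 : s p = s' p' := by simpa using h 0 (by omega) (by omega)
  have hag : Agree M s p s' p' := fun k h1 h2 => h k (by omega) h2
  have hp' : ¬ ConstWindow μ M s' p' := fun hw => hp fun q h1 h2 => by
    have e1 := h (q - p) (by omega) (by omega)
    rw [show p + (q - p) = q by ring] at e1
    rw [e1, h0]
    exact hw _ (by omega) (by omega)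
  have hzone : Zone μ κ s p ↔ Zone μ κ s' p' :=
    ⟨Zone.congr (by omega) hag, Zone.congr (by omega) hag.symm⟩
  unfold cutRule
  rw [if_neg hp, if_neg hp']
  by_cases hz : Zone μ κ s p
  · have hz' := hzone.1 hz
    rw [if_neg (not_not.2 hz), if_neg (not_not.2 hz')]
    obtain ⟨r1, r2, r3, r4⟩ := exists_runAfter hp hz
    have hr : runAfter s' p' = runAfter s p := by
      refine runAfter_eq ?_ fun k hk => ?_
      · rw [← h _ (by omega) (by omega), ← h0]; exact r3
      · rw [← h k (by omega) (by omega), ← h0]; exact r4 _ (by omega) (by omega)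
    have hlong : LongRun μ M s p ↔ LongRun μ M s' p' := by
      unfold LongRun
      rw [hr]
      constructor
      · intro hl q h1 h2
        have e1 := h (q - p') (by omega) (by omega)
        rw [show p' + (q - p') = q by ring] at e1
        rw [← e1, ← h0]
        exact hl _ (by omega) (by omega)
      · intro hl q h1 h2
        have e1 := h (q - p) (by omega) (by omega)
        rw [show p + (q - p) = q by ring] at e1
        rw [e1, h0]
        exact hl _ (by omega) (by omega)
    by_cases hl : LongRun μ M s p
    · rw [if_pos hl, if_pos (hlong.1 hl), hr, h0, h _ (by omega) (by omega)]
    · rw [if_neg hl, if_neg (hlong.not.1 hl), hr, h0]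
      obtain ⟨l1, l2, l3, l4⟩ := exists_runBefore hl hz
      have hlb : runBefore s' p' = runBefore s p := by
        refine runBefore_eq ?_ fun k hk => ?_
        · have := h (-runBefore s p) (by omega) (by omega)
          rw [← sub_eq_add_neg, ← sub_eq_add_neg] at this
          rw [← this, ← h0]; exact l3
        · have := h (-k) (by omega) (by omega)
          rw [← sub_eq_add_neg, ← sub_eq_add_neg] at this
          rw [← this, ← h0]; exact l4 _ (by omega) (by omega)
      rw [hlb]
  · rw [if_pos hz, if_pos (hzone.not.1 hz)]
    exact hθ _ _ _ _ (hag.mono hρ) hz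

theorem cutRule_of_constWindow (h : ConstWindow μ M s p) :
    cutRule G x v₀ θ κ μ M s p = x (s p) (s (p + M + 1)) := if_pos h

theorem constWindow_congr (h : ∀ k : ℤ, -μ ≤ k → k ≤ M → s (p + k) = s' (p' + k))
    (hp : ConstWindow μ M s p) : ConstWindow μ M s' p' := fun q h1 h2 => by
  have e0 := h 0 (by omega) (by omega)
  have e1 := h (q - p') (by omega) (by omega)
  rw [show p' + (q - p') = q by ring] at e1
  rw [add_zero, add_zero] at e0
  rw [← e1, ← e0]
  exact hp _ (by omega) (by omega)

/-- This is the source of the edge x i i → T (x i). Either `p` has a constant window too, and the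
letter it reads ahead still belongs to the next window, or `p` is the last position before a zone.
-/
theorem cutRule_of_constWindow_succ (hμ : 1 ≤ μ) (hM : κ + μ + 1 ≤ M)
    (hy : ∀ s p, ¬ Zone μ κ s p → Zone μ κ s (p + 1) → θ s p = x (s (p + 1)) (s (p + 1)))
    (h : ConstWindow μ M s (p + 1)) :
    cutRule G x v₀ θ κ μ M s p = x (s (p + 1)) (s (p + 1)) := by
  have hs : s p = s (p + 1) := h p (by omega) (by omega)
  by_cases hp : ConstWindow μ M s p
  · rw [cutRule_of_constWindow hp, hs, h (p + M + 1) (by omega) (by omega)]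
  · have hz1 : Zone μ κ s (p + 1) := h.zone (by omega)
    have hz : ¬ Zone μ κ s p := fun hz => hp fun q h1 h2 => by
      by_cases hq : q = p - μ
      · exact hz.const (by omega) (by omega)
      · rw [hs]
        exact h q (by omega) (by omega)
    rw [cutRule, if_neg hp, if_pos hz, hy _ _ hz hz1]

/-- The filling walks match their surroundings. In a long run, vertex 0 is at the last constant
window, where `runAfter` is `M + 1`; in a short one it is just before the zone, where `runBefore` is
`μ`. Both end at `v₀` just after the zone, where `runAfter` is `μ`. Their lengths are at least `κ`
by `hM` and `le_run_of_zone`. -/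
theorem cutRule_adj (hμ : 1 ≤ μ) (hM : κ + μ + 1 ≤ M)
    (hθ : ∀ s p, ¬ Zone μ κ s p → ¬ Zone μ κ s (p + 1) → G.Adj (θ s p) (θ s (p + 1)))
    (hy : ∀ s p, ¬ Zone μ κ s p → Zone μ κ s (p + 1) → θ s p = x (s (p + 1)) (s (p + 1)))
    (hv₀ : ∀ s p, Zone μ κ s p → ¬ Zone μ κ s (p + 1) → θ s (p + 1) = v₀)
    (hx : ∀ i j g, κ ≤ g → Walk G g (x i j) v₀) (h : ¬ ConstWindow μ M s (p + 1)) :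
    G.Adj (cutRule G x v₀ θ κ μ M s p) (cutRule G x v₀ θ κ μ M s (p + 1)) := by
  by_cases hp : ConstWindow μ M s p
  · have hs1 : s (p + 1) = s p := hp _ (by omega) (by omega)
    have hne : s (p + 1 + M) ≠ s (p + 1) := fun he => h fun q h1 h2 => by
      by_cases hq : q = p + 1 + M
      · rw [hq, he]
      · rw [hs1]
        exact hp _ (by omega) (by omega)
    have hz1 : Zone μ κ s (p + 1) := Zone.of_const (by omega) fun q h1 h2 => by
      rw [hs1]
      exact hp _ (by omega) (by omega)
    have hr : runAfter s (p + 1) = M := runAfter_eq hne fun k hk => by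
      rw [hs1]
      exact hp _ (by omega) (by omega)
    have hl : LongRun μ M s (p + 1) := fun q h1 h2 => by
      rw [hr] at h1
      rw [hs1]
      exact hp _ (by omega) (by omega)
    rw [cutRule_of_constWindow hp, cutRule, if_neg h, if_neg (not_not.2 hz1), if_pos hl, hr, hs1,
      show p + (M : ℤ) + 1 = p + 1 + M by ring, show M + 1 - M = 0 + 1 by omega]
    have := walkVertex_adj (hx (s p) (s (p + 1 + M)) (M + 1 - μ) (by omega)) (k := 0) (by omega)
    rwa [walkVertex_zero] at this
  by_cases hz : Zone μ κ s p
  · have hs1 : s (p + 1) = s p := hz.const (by omega) (by omega)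
    obtain ⟨r1, r2, r3, r4⟩ := exists_runAfter hp hz
    by_cases hz1 : Zone μ κ s (p + 1)
    · have hr : runAfter s (p + 1) = runAfter s p - 1 := by
        refine runAfter_eq ?_ fun k hk => ?_
        · rwa [show p + 1 + ((runAfter s p - 1 : ℕ) : ℤ) = p + runAfter s p by omega, hs1]
        · rw [hs1]
          exact r4 _ (by omega) (by omega)
      have hlong : LongRun μ M s (p + 1) ↔ LongRun μ M s p := by
        unfold LongRun
        rw [hr, hs1]
        constructor
        · exact fun hl q h1 h2 => hl q (by omega) (by omega)
        · intro hl q h1 h2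
          by_cases hq : q = p + 1
          · rw [hq, hs1]
          · exact hl q (by omega) (by omega)
      rw [cutRule, cutRule, if_neg hp, if_neg h, if_neg (not_not.2 hz), if_neg (not_not.2 hz1)]
      by_cases hl : LongRun μ M s p
      · rw [if_pos hl, if_pos (hlong.2 hl), hr, hs1,
          show p + 1 + ((runAfter s p - 1 : ℕ) : ℤ) = p + runAfter s p by omega,
          show M + 1 - (runAfter s p - 1) = M + 1 - runAfter s p + 1 by omega]
        exact walkVertex_adj (hx _ _ _ (by omega)) (by omega)
      · rw [if_neg hl, if_neg (hlong.not.2 hl), hr, hs1]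
        obtain ⟨l1, l2, l3, l4⟩ := exists_runBefore hl hz
        have hlb : runBefore s (p + 1) = runBefore s p + 1 := by
          refine runBefore_eq ?_ fun k hk => ?_
          · rwa [show p + 1 - ((runBefore s p + 1 : ℕ) : ℤ) = p - runBefore s p by omega, hs1]
          · by_cases hk0 : k = 0
            · simp [hk0]
            · rw [hs1]
              exact l4 _ (by omega) (by omega)
        rw [hlb, show runBefore s p + 1 + (runAfter s p - 1) =
            runBefore s p + runAfter s p by omega,
          show runBefore s p + 1 - μ = runBefore s p - μ + 1 by omega]
        have := le_run_of_zone hz l3 r3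
        exact walkVertex_adj (hx _ _ _ (by omega)) (by omega)
    · have hr : runAfter s p = μ + 1 := by
        by_contra hne
        refine hz1 (hz.succ (by omega) (r4 _ (by omega) (by omega)))
      rw [cutRule, cutRule, if_neg hp, if_neg h, if_neg (not_not.2 hz), if_pos hz1,
        hv₀ _ _ hz hz1, hr]
      by_cases hl : LongRun μ M s p
      · rw [if_pos hl]
        have hw := hx (s p) (s (p + (μ + 1 : ℕ))) (M + 1 - μ) (by omega)
        have := walkVertex_adj hw (k := M + 1 - (μ + 1)) (by omega)
        rwa [show M + 1 - (μ + 1) + 1 = M + 1 - μ by omega, walkVertex_last hw] at this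
      · rw [if_neg hl]
        obtain ⟨l1, l2, l3, l4⟩ := exists_runBefore hl hz
        have hlen := le_run_of_zone hz l3 r3
        have hw := hx (s p) (s p) (runBefore s p + (μ + 1) - 2 * μ) (by omega)
        have := walkVertex_adj hw (k := runBefore s p - μ) (by omega)
        rwa [show runBefore s p - μ + 1 = runBefore s p + (μ + 1) - 2 * μ by omega,
          walkVertex_last hw] at this
  · by_cases hz1 : Zone μ κ s (p + 1)
    · obtain ⟨r1, r2, r3, r4⟩ := exists_runAfter h hz1
      have hne : s (p - μ) ≠ s (p + 1) := fun he => hz (hz1.pred (by omega) he)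
      -- A zone begins here without a constant window, so its run is too short for one.
      have hl : ¬ LongRun μ M s (p + 1) := fun hl => hne (hl _ (by omega) (by omega))
      obtain ⟨l1, l2, l3, l4⟩ := exists_runBefore hl hz1
      have hlb : runBefore s (p + 1) = μ + 1 := by
        by_contra hcon
        exact hne (l4 _ (by omega) (by omega))
      have hlen := le_run_of_zone hz1 l3 r3
      rw [cutRule, cutRule, if_neg hp, if_neg h, if_pos hz, if_neg (not_not.2 hz1), if_neg hl,
        hy _ _ hz hz1, hlb, show μ + 1 - μ = 0 + 1 by omega]
      have := walkVertex_adj (hx (s (p + 1)) (s (p + 1)) (μ + 1 + runAfter s (p + 1) - 2 * μ)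
        (by omega)) (k := 0) (by omega)
      rwa [walkVertex_zero] at this
    · rw [cutRule, cutRule, if_neg hp, if_neg h, if_pos hz, if_pos hz1]
      exact hθ s p hz hz1

end CutRule

/-! ### Assembly for digraphs with cycle walks of all lengths above one -/

/-- A homomorphism outside the zones yields a labelling of words and thereby a loop. -/
theorem exists_loop_of_local_rule {A I : Type*} {G : Digraph A} {T : (I → A) → A}
    (hT : ∀ x, T (fun _ => x) = x)
    (hG : ∀ x y : I → A, (∀ j, G.Adj (x j) (y j)) → G.Adj (T x) (T y)) (i₀ : I)
    {x : I → I → A} (hx : ∀ i, G.Adj (x i i) (T (x i))) {v₀ : A} {κ μ : ℕ} {ρ : ℤ}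
    {θ : (ℤ → I) → ℤ → A} (hμ : 1 ≤ μ)
    (hθ1 : ∀ s p s' p', Agree ρ s p s' p' → ¬ Zone μ κ s p → θ s p = θ s' p')
    (hθ2 : ∀ s p, ¬ Zone μ κ s p → ¬ Zone μ κ s (p + 1) → G.Adj (θ s p) (θ s (p + 1)))
    (hθ3 : ∀ s p, ¬ Zone μ κ s p → Zone μ κ s (p + 1) → θ s p = x (s (p + 1)) (s (p + 1)))
    (hθ4 : ∀ s p, Zone μ κ s p → ¬ Zone μ κ s (p + 1) → θ s (p + 1) = v₀)
    (hxw : ∀ i j g, κ ≤ g → Walk G g (x i j) v₀) : ∃ v, G.Adj v v := by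
  obtain ⟨M, hM, hρM⟩ : ∃ M : ℕ, κ + μ + 1 ≤ M ∧ ρ ≤ M := ⟨κ + μ + 1 + ρ.toNat, by omega, by omega⟩
  obtain ⟨c, hc⟩ : ∃ c : ℕ, c = μ + M + 1 := ⟨_, rfl⟩
  have hcongr : ∀ {s s' : ℤ → I} {p p' : ℤ},
      (∀ k : ℤ, -c ≤ k → k ≤ M + 1 → s (p + k) = s' (p' + k)) →
      cutRule G x v₀ θ κ μ M s p = cutRule G x v₀ θ κ μ M s' p' := fun {s s' p p'} h => by
    by_cases hp : ConstWindow μ M s p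
    · have h0 := h 0 (by omega) (by omega)
      rw [add_zero, add_zero] at h0
      rw [cutRule_of_constWindow hp, cutRule_of_constWindow
        (constWindow_congr (fun k h1 h2 => h k (by omega) (by omega)) hp), h0, add_assoc,
        h (M + 1) (by omega) le_rfl, add_assoc]
    · exact cutRule_congr hρM (by omega) hc.ge hθ1 (fun k h1 h2 => h k h1 (by omega)) hp
  -- Words have `c + M + 2` letters: `c` before the centre and `M + 1` after it.
  refine exists_loop_of_list hT hG (c + M + 1)
    (fun l => cutRule G x v₀ θ κ μ M (fun k => l.getD k.toNat i₀) c) fun i u hu => ?_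
  generalize hs : (fun k : ℤ => (i :: u).getD k.toNat i₀) = s
  -- Appending `j` after dropping `i` moves the centre by one and changes only the last letter seen.
  have key : ∀ j, cutRule G x v₀ θ κ μ M (fun k => (u ++ [j]).getD k.toNat i₀) c =
      cutRule G x v₀ θ κ μ M (Function.update s (c + 1 + M + 1) j) (c + 1) := fun j => by
    refine hcongr fun k h1 h2 => ?_
    by_cases hk : k = M + 1
    · subst hk
      rw [show (c : ℤ) + 1 + (M + 1) = c + 1 + M + 1 by ring, Function.update_self,
        show ((c : ℤ) + (M + 1)).toNat = u.length by omega]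
      simp
    · rw [Function.update_of_ne (by omega), ← hs]
      dsimp only
      rw [show ((c : ℤ) + 1 + k).toNat = (c + k).toNat + 1 by omega, List.getD_cons_succ,
        List.getD_append _ _ _ _ (by omega)]
  simp only [key]
  by_cases hw : ConstWindow μ M s (c + 1)
  · rw [cutRule_of_constWindow_succ (by omega) hM hθ3 hw]
    convert hx (s (c + 1)) using 2
    funext j
    rw [cutRule_of_constWindow, Function.update_self, Function.update_of_ne (by omega)]
    exact constWindow_congr (fun k h1 h2 => (Function.update_of_ne (by omega) _ _).symm) hw
  -- Without a constant window the last letter is not read, so T acts on a constant tuple.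
  · have hconst : ∀ j, cutRule G x v₀ θ κ μ M (Function.update s (c + 1 + M + 1) j) (c + 1) =
        cutRule G x v₀ θ κ μ M s (c + 1) := fun j =>
      (cutRule_congr hρM (by omega) hc.ge hθ1
        (fun k h1 h2 => (Function.update_of_ne (by omega) _ _).symm) hw).symm
    simp only [hconst, hT]
    exact cutRule_adj (by omega) hM hθ2 hθ3 hθ4 hxw hw

/-- The loop lemma for an operation of arbitrary finite arity, with a single step `P(T, i)` in
place of walks. -/
theorem exists_loop_of_steps {A I : Type*} [Finite I] {G : Digraph A} {T : (I → A) → A}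
    (hT : ∀ x, T (fun _ => x) = x)
    (hG : ∀ x y : I → A, (∀ j, G.Adj (x j) (y j)) → G.Adj (T x) (T y))
    (hsc : ∀ u v, ∃ g, Walk G g u v) (hcyc : ∀ m, 2 ≤ m → ∃ z, Walk G m z z)
    (x : I → I → A) (hx : ∀ i, G.Adj (x i i) (T (x i))) : ∃ v, G.Adj v v := by
  classical
  obtain ⟨v₀, -⟩ := hcyc 2 le_rfl
  rcases isEmpty_or_nonempty I with hI | ⟨⟨i₀⟩⟩
  · exact exists_loop_of_list hT hG 0 (fun _ => v₀) fun i => isEmptyElim i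
  cases nonempty_fintype I
  -- The order avoids circularity: `K` depends on `v₀` only, the vertices `z m` are chosen for m <
  -- `K`, and `κ` then serves all vertices in use.
  obtain ⟨K₀, hK₀⟩ := exists_uniform_walk hsc hcyc {v₀}
  obtain ⟨K, hK₀K, h2K⟩ : ∃ K, K₀ ≤ K ∧ 2 ≤ K := ⟨max K₀ 2, le_max_left _ _, le_max_right _ _⟩
  have hz : ∃ z : ℕ → A, (∀ m, 2 ≤ m → m < K → Walk G m (z m) (z m)) ∧
      ∀ m, K ≤ m → z m = v₀ := by
    have : ∀ m, ∃ z, (2 ≤ m → m < K → Walk G m z z) ∧ (K ≤ m → z = v₀) := fun m => by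
      by_cases hm : 2 ≤ m ∧ m < K
      · obtain ⟨z, hz⟩ := hcyc m hm.1
        exact ⟨z, fun _ _ => hz, fun h => by omega⟩
      · exact ⟨v₀, fun h h' => absurd ⟨h, h'⟩ hm, fun _ => rfl⟩
    choose z hz using this
    exact ⟨z, fun m => (hz m).1, fun m => (hz m).2⟩
  obtain ⟨z, hz, hzv⟩ := hz
  obtain ⟨F, hv₀F, hzF, hxF⟩ : ∃ F : Finset A, v₀ ∈ F ∧ (∀ m, z m ∈ F) ∧ ∀ i j, x i j ∈ F := by
    refine ⟨insert v₀ ((Finset.range K).image z ∪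
      (Finset.univ : Finset (I × I)).image fun ij => x ij.1 ij.2), by simp, fun m => ?_,
      fun i j => ?_⟩
    · rcases lt_or_ge m K with hm | hm
      · exact Finset.mem_insert_of_mem (Finset.mem_union_left _
          (Finset.mem_image_of_mem _ (Finset.mem_range.2 hm)))
      · rw [hzv m hm]
        exact Finset.mem_insert_self _ _
    · exact Finset.mem_insert_of_mem (Finset.mem_union_right _
        (Finset.mem_image.2 ⟨(i, j), Finset.mem_univ _, rfl⟩))
  obtain ⟨K₁, hK₁⟩ := exists_uniform_walk hsc hcyc F
  obtain ⟨κ, hK₁κ, hKκ⟩ : ∃ κ, K₁ ≤ κ ∧ K ≤ κ := ⟨max K₁ K, le_max_left _ _, le_max_right _ _⟩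
  obtain ⟨μ, hμ⟩ : ∃ μ : ℕ, μ = 4 * K + κ + 2 := ⟨_, rfl⟩
  obtain ⟨ρ, θ, -, hθ1, hθ2, hθ3, hθ4⟩ := exists_local_rule (I := I) (μ := μ) (F := (F : Set A))
    (y := fun i => x i i) (by exact_mod_cast hμ) h2K hKκ hv₀F hzF (fun i => hxF i i)
    (fun u hu v hv g hg => hK₁ u hu v hv g (hK₁κ.trans hg))
    (fun g hg => hK₀ v₀ (by simp) v₀ (by simp) g (hK₀K.trans hg)) hz
  exact exists_loop_of_local_rule hT hG i₀ hx (by omega) hθ1 hθ2 hθ3 hθ4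
    fun i j g hg => hK₁ _ (hxF i j) _ hv₀F g (hK₁κ.trans hg)

/-- The strong local loop lemma for a digraph with closed walks of all lengths greater than one. -/
theorem exists_loop_of_walks {A : Type*} {n : ℕ} {t : (Fin n → A) → A} {G : Digraph A}
    (h_idem : Idempotent t) (h_comp : Compatible G t) (hsc : ∀ u v, ∃ g, Walk G g u v)
    (hcyc : ∀ m, 2 ≤ m → ∃ z, Walk G m z z) (a b : Fin n → A)
    (h_edge : ∀ i, G.Adj (a i) (b i) ∧ (transClosure (coordDigraph t i)).Adj (a i) (b i)) :
    ∃ v, G.Adj v v := by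
  rcases Nat.eq_zero_or_pos n with rfl | hn
  · obtain ⟨z, hz⟩ := hcyc 2 le_rfl
    obtain ⟨y, -, hy⟩ := hz
    -- A nullary operation is constant, so idempotence leaves only one vertex.
    have : y = z := by
      rw [← h_idem y, ← h_idem z]
      exact congrArg t (Subsingleton.elim _ _)
    subst this
    exact ⟨y, hy⟩
  have : Nonempty (Fin n) := ⟨⟨0, hn⟩⟩
  choose ℓ hℓ using fun i => exists_walk_of_transGen (h_edge i).2
  have hstep : ∀ w : Fin (n * ∑ i, ℓ i) → Fin n, ∃ x : (Fin (n * ∑ i, ℓ i) → Fin n) → A,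
      G.Adj (x w) (treeOp t (n * ∑ i, ℓ i) x) := fun w => by
    -- Pigeonhole: some letter fills at least `∑ i, ℓ i` of the positions, enough for its own walk.
    obtain ⟨i, hi⟩ := Fintype.exists_le_card_fiber_of_mul_le_card (n := ∑ i, ℓ i) w (by simp)
    obtain ⟨x, hx, hx'⟩ := exists_treeOp_eq h_idem i _ w (ℓ i)
      ((Finset.single_le_sum (fun _ _ => Nat.zero_le _) (Finset.mem_univ i)).trans hi) _ _ (hℓ i)
    exact ⟨x, by rw [hx, hx']; exact (h_edge i).1⟩
  choose x hx using hstep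
  exact exists_loop_of_steps (treeOp_const h_idem _) (treeOp_compatible h_comp _) hsc hcyc x hx

/-! ### The undirected case -/

theorem Walk.add_two_mul {A : Type*} {G : Digraph A} (hG : Undirected G) {g : ℕ} {u v : A}
    (h : Walk G (g + 1) u v) (k : ℕ) : Walk G (g + 1 + 2 * k) u v := by
  induction k with
  | zero => exact h
  | succ k ih =>
    obtain ⟨x, -, hx⟩ := h
    exact ⟨x, ⟨v, ih, hG _ _ hx⟩, hx⟩

/-- Otherwise the parity of walks from a root is well defined and gives a bipartition. -/
theorem exists_odd_walk {A : Type*} {G : Digraph A} (hG : Undirected G)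
    (hsc : ∀ u v, ∃ g, Walk G g u v) (hb : ¬ Bipartite G) : ∃ (m : ℕ) (v : A),
      Walk G (2 * m + 1) v v := by
  by_contra! hcon
  have hodd : ∀ g v, Walk G g v v → Even g := fun g v h => by
    rcases Nat.even_or_odd' g with ⟨m, rfl | rfl⟩
    · simp
    · exact absurd h (hcon m v)
  rcases isEmpty_or_nonempty A with hA | ⟨⟨r⟩⟩
  · exact hb ⟨∅, fun u => isEmptyElim u⟩
  · refine hb ⟨{u | ∃ m, Walk G (2 * m) r u}, fun u v huv => ?_⟩
    simp only [Set.mem_ofPred_eq]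
    constructor
    · rintro ⟨m, hm⟩ ⟨m', hm'⟩
      have := hodd _ _ ((hm.trans (Walk.single huv)).trans (hm'.symm hG))
      grind
    · intro hv
      obtain ⟨g, hg⟩ := hsc r u
      rcases Nat.even_or_odd' g with ⟨m, rfl | rfl⟩
      · exact ⟨m, hg⟩
      · exact absurd ⟨m + 1, (hg.trans (Walk.single huv)).congr (by ring)⟩ hv

/-- The strong local loop lemma for an undirected graph. -/
theorem exists_loop_of_undirected {A : Type*} {n : ℕ} {t : (Fin n → A) → A} {G : Digraph A}
    (h_idem : Idempotent t) (h_comp : Compatible G t) (hG : Undirected G)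
    (hsc : ∀ u v, ∃ g, Walk G g u v) (hb : ¬ Bipartite G) (a b : Fin n → A)
    (h_edge : ∀ i, G.Adj (a i) (b i) ∧ (transClosure (coordDigraph t i)).Adj (a i) (b i)) :
    ∃ v, G.Adj v v := by
  classical
  have hex := exists_odd_walk hG hsc hb
  obtain ⟨v, hv⟩ := Nat.find_spec hex
  have hmin := fun k => Nat.find_min hex (m := k)
  generalize Nat.find hex = m at *
  rcases m with _ | m
  · exact ⟨v, walk_one.1 hv⟩
  exfalso
  -- The shortest odd closed walk has length 2m + 3. A loop of `H` would be a closed walk of length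
  -- 2m + 1, so it contradicts minimality.
  let H : Digraph A := ⟨Walk G (2 * m + 1)⟩
  have hH : ∀ k u v, Walk H k u v ↔ Walk G (k * (2 * m + 1)) u v := by
    intro k
    induction k with
    | zero => intro u v; rw [Nat.zero_mul]; rfl
    | succ k ih =>
      intro u v
      constructor
      · rintro ⟨x, hx, hxv⟩
        exact (((ih _ _).1 hx).trans hxv).congr (by ring)
      · intro h
        have h' : ∀ (g k : ℕ) (v : A), Walk G (k + g) u v → ∃ x, Walk G k u x ∧ Walk G g x v := by
          intro g k
          induction g with
          | zero => intro v h; exact ⟨v, h, rfl⟩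
          | succ g ihg =>
            rintro v ⟨y, hy, hyv⟩
            obtain ⟨x, hx, hxy⟩ := ihg y hy
            exact ⟨x, hx, y, hxy, hyv⟩
        obtain ⟨x, hx, hxv⟩ := h' (2 * m + 1) (k * (2 * m + 1)) v (h.congr (by ring))
        exact ⟨x, (ih _ _).2 hx, hxv⟩
  have hGH : ∀ u v, G.Adj u v → H.Adj u v := fun u v h =>
    ((Walk.single h).add_two_mul hG m).congr (by ring)
  have hGHw : ∀ g u v, Walk G g u v → Walk H g u v := by
    intro g
    induction g with
    | zero => exact fun _ _ h => h
    | succ g ih => rintro u v ⟨x, hx, hxv⟩; exact ⟨x, ih _ _ hx, hGH _ _ hxv⟩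
  -- 3(2m + 1) = (2m + 3) + 4m, and walks can be lengthened by two.
  have h3 : Walk H 3 v v := (hH 3 v v).2 ((hv.add_two_mul hG (2 * m)).congr (by ring))
  have h2 : Walk H 2 v v := by
    obtain ⟨x, -, hx⟩ := hv
    exact ⟨x, Walk.single (hGH _ _ (hG _ _ hx)), hGH _ _ hx⟩
  obtain ⟨w, hw⟩ := exists_loop_of_walks (G := H) h_idem
    (fun x y h => Walk.compatible h_comp _ x y h)
    (fun u v => (hsc u v).imp fun g h => hGHw g u v h)
    (fun k hk => ⟨v, by
      rcases Nat.even_or_odd' k with ⟨j, rfl | rfl⟩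
      · exact (h2.mul j).congr (by ring)
      · exact ((h2.mul (j - 1)).trans h3).congr (by omega)⟩)
    a b fun i => ⟨hGH _ _ (h_edge i).1, (h_edge i).2⟩
  exact hmin m (Nat.lt_succ_self m) ⟨w, hw⟩

theorem StronglyConnected.exists_walk {A : Type*} {G : Digraph A} (h : StronglyConnected G)
    (u v : A) : ∃ g, Walk G g u v := by
  obtain ⟨m, w, hw, rfl, rfl⟩ := h u v
  exact ⟨m, walk_of_isWalk w hw⟩

end LoopLemma

/-- The strong local loop lemma. For an undirected graph, being connected is the same as any two
vertices being joined by a walk, which is what `StronglyConnected` says. -/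
theorem mainTheorem5 {A : Type*} {n : ℕ} (t : (Fin n → A) → A) (G : Digraph A)
    (a b : Fin n → A)
    (h_idem : LoopLemma.Idempotent t)
    (h_comp : LoopLemma.Compatible G t)
    (h_graph :
      (LoopLemma.StronglyConnected G ∧
        ∀ m : ℕ, 1 < m → ∃ w : Fin (m + 1) → A, LoopLemma.IsCycleWalk G w) ∨
      (LoopLemma.Undirected G ∧ LoopLemma.StronglyConnected G ∧ ¬ LoopLemma.Bipartite G))
    (h_edge : ∀ i : Fin n, G.Adj (a i) (b i) ∧
      (LoopLemma.transClosure (LoopLemma.coordDigraph t i)).Adj (a i) (b i)) :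
    ∃ v : A, G.Adj v v := by
  rcases h_graph with ⟨hsc, hcyc⟩ | ⟨hG, hsc, hb⟩
  · refine LoopLemma.exists_loop_of_walks h_idem h_comp hsc.exists_walk (fun m hm => ?_) a b h_edge
    obtain ⟨w, hw, hw'⟩ := hcyc m hm
    have := LoopLemma.walk_of_isWalk w hw
    rw [← hw'] at this
    exact ⟨_, this⟩
  · exact LoopLemma.exists_loop_of_undirected h_idem h_comp hG hsc.exists_walk hb a b h_edge
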